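/- All graphs are finite and simple. Let $G$ be a connected graph and let $f$ assign a positive integer $f(v)$ to every vertex $v\in V(G)$. An $f$-coloring of $G$ is a coloring of the edges of $G$ in which, for every vertex $v$ and every color, at most $f(v)$ of the edges incident with $v$ have that color; the $f$-chromatic index $\chi'_f(G)$ is the minimum number of colors in an $f$-coloring of $G$. Put $\Delta_f(G)=\max_{v\in V(G)}\lceil d_G(v)/f(v)\rceil$, where $d_G(v)$ is the degree of $v$, and let the $f$-core $G_{\Delta_f}$ be the subgraph of $G$ induced on the set of vertices $v$ with $d_G(v)=f(v)\Delta_f(G)$. An edge cut of $G$ is a set of edges whose removal produces a graph with more connected components than $G$. **Theorem.** Suppose that the maximum degree of $G_{\Delta_f}$ is at most $2$ (the graph without vertices having maximum degree $0$), and that $G$ has an edge cut of size at most $\Delta_f(G)-2$ which is a matching (no two of its edges share an end) or a star (all its edges share a common end). Then $G$ is $f$-Class $1$, that is, $\chi'_f(G)=\Delta_f(G)$. -/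

import Mathlib

namespace FColoring

variable {V : Type*}

/-- An edge coloring `c` of `G` is an `f`-coloring if, at each vertex `v`, every color
occurs on at most `f v` of the edges incident with `v`. (Used on finite graphs, so that `ncard`
is the honest number of elements.) -/
def IsFColoring (G : SimpleGraph V) (f : V → ℕ) {α : Type*} (c : G.edgeSet → α) : Prop :=
  ∀ (v : V) (a : α), {e : G.edgeSet | v ∈ (e : Sym2 V) ∧ c e = a}.ncard ≤ f v

/-- `G` has an `f`-coloring with (at most) `k` colors. -/
def IsFColorable (G : SimpleGraph V) (f : V → ℕ) (k : ℕ) : Prop :=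
  ∃ c : G.edgeSet → Fin k, IsFColoring G f c

/-- If `f` is positive, a finite graph has an `f`-coloring: give all edges different colors.
Hence the infimum in `fChromaticIndex` below is a minimum. -/
theorem exists_isFColorable [Finite V] (G : SimpleGraph V) (f : V → ℕ) (hf : ∀ v, 0 < f v) :
    ∃ k, IsFColorable G f k := by
  obtain ⟨k, ⟨e⟩⟩ := Finite.exists_equiv_fin G.edgeSet
  refine ⟨k, e, fun v a => le_trans ?_ (hf v)⟩
  refine (Set.ncard_le_one (Set.toFinite _)).2 fun x hx y hy => ?_
  exact e.injective (hx.2.trans hy.2.symm)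

/-- The `f`-chromatic index: the minimum number of colors in an `f`-coloring of `G`. -/
noncomputable def fChromaticIndex (G : SimpleGraph V) (f : V → ℕ) : ℕ :=
  sInf {k | IsFColorable G f k}

open scoped Classical in
/-- `Δ_f(G)`, the maximum over all vertices `v` of `⌈d(v) / f(v)⌉`. -/
noncomputable def fMaxDegree [Fintype V] (G : SimpleGraph V) (f : V → ℕ) : ℕ :=
  Finset.univ.sup fun v => ⌈(G.degree v : ℚ) / (f v : ℚ)⌉₊

/-- `G` is `f`-Class 1. -/
def IsFClassOne [Fintype V] (G : SimpleGraph V) (f : V → ℕ) : Prop :=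
  fChromaticIndex G f = fMaxDegree G f

open scoped Classical in
/-- The set of `f`-maximum vertices. -/
def fMaxVertices [Fintype V] (G : SimpleGraph V) (f : V → ℕ) : Set V :=
  {v | G.degree v = f v * fMaxDegree G f}

/-- The `f`-core of `G`: the subgraph induced on the `f`-maximum vertices. -/
def fCore [Fintype V] (G : SimpleGraph V) (f : V → ℕ) : SimpleGraph (fMaxVertices G f) :=
  G.induce (fMaxVertices G f)

open scoped Classical in
/-- The maximum degree of the `f`-core (zero if the `f`-core has no vertices). -/
noncomputable def fCoreMaxDegree [Fintype V] (G : SimpleGraph V) (f : V → ℕ) : ℕ :=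
  (fCore G f).maxDegree

/-- An edge cut of `G`: a set of edges of `G` whose removal produces a graph with more
connected components than `G`. -/
def IsEdgeCut (G : SimpleGraph V) (F : Finset (Sym2 V)) : Prop :=
  (F : Set (Sym2 V)) ⊆ G.edgeSet ∧
    Nat.card G.ConnectedComponent <
      Nat.card (G.deleteEdges (F : Set (Sym2 V))).ConnectedComponent

/-- A set of edges is a matching if no two distinct members share an end. -/
def IsMatchingEdges (F : Finset (Sym2 V)) : Prop :=
  ∀ e ∈ F, ∀ e' ∈ F, e ≠ e' → ∀ v : V, ¬ (v ∈ e ∧ v ∈ e')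

/-- A set of edges of a simple graph is a star if its members all share a common end. -/
def IsStarEdges (F : Finset (Sym2 V)) : Prop :=
  ∃ u : V, ∀ e ∈ F, u ∈ e

end FColoring

/-! Write k for Δ_f(G) and call v a core vertex if deg v = f(v)k. The colors are counted vertex by
vertex; a color is missing at v if it occurs there fewer than f(v) times. The proof combines a
Vizing-type adjacency lemma with a decomposition along the cut.

Adjacency. Suppose G has no k-coloring but G - xy has one. Grow the Vizing fan at x from y. No fan
vertex misses a color missing at x, since otherwise shifting colors along the fan would color xy.
Kempe chains show more: for each color b, the multiplicities with which the fan vertices miss b add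
up to at most f(x) (`sum_missing_le`). When this sum is positive, x sees b exactly f(x) times and
all those neighbors lie in the fan, so summing over b bounds the total deficiency of the fan by its
size minus one. Hence x has many core neighbors (`le_card_core_neighbors`).

Rigidity. Apply this to every edge of a minimal uncolorable subgraph. As core vertices have at most
two core neighbors, the subgraph is a union of full components of G, in which every degree is at
least f(v)k - 1 (`exists_closed_of_not_good`). So a vertex of capacity 1 and degree at most k - 2
cannot lie in such a union.

Cut. It suffices to color each side of the cut with distinct colors on the cut edges and then
permute colors to match (`exists_good_of_sideGood`). A side whose vertices have at most one neighbor
across is handled by contracting the other side to a vertex z of capacity 1: z has degree at most k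
- 2, so by rigidity an obstruction would avoid z and contradict connectedness. For the side
containing the center u of a star, u is split instead: z takes some of its inner edges, with
capacity 1, and u keeps the others, with capacity f(u) - 1. Colors unused at z then serve the cut
edges (`exists_good_of_star_cut`). -/

namespace FColoring

open Finset
open scoped Classical

set_option linter.unusedSectionVars false

/-! ### Pairs of involutions: the ends of Kempe chains. -/

section Involutions

variable {D : Type*} [Finite D]

/-- Two involutions `ι`, `π` of a finite set, the first without fixed points: the orbit of a fixed
point of `π` contains exactly one other fixed point of `π`. -/
theorem exists_mate (ι π : Equiv.Perm D) (hι : ∀ d, ι (ι d) = d) (hπ : ∀ d, π (π d) = d)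
    (hfix : ∀ d, ι d ≠ d) (e : D) (he : π e = e) :
    (∀ d, (π * ι).SameCycle e d → (π * ι).SameCycle e (ι d) ∧ (π * ι).SameCycle e (π d)) ∧
    ∃ m, m ≠ e ∧ (π * ι).SameCycle e m ∧ π m = m ∧
      ∀ d, (π * ι).SameCycle e d → π d = d → d = e ∨ d = m := by
  set τ := π * ι with hτ
  have hπ1 : π⁻¹ = π := by
    ext d; rw [Equiv.Perm.inv_eq_iff_eq]; exact (hπ d).symm
  have hι1 : ι⁻¹ = ι := by
    ext d; rw [Equiv.Perm.inv_eq_iff_eq]; exact (hι d).symm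
  -- The action is dihedral: on the points τ^i e, `π` acts by i ↦ -i and `ι` by i ↦ -(i + 1).
  have hconj : π * τ * π⁻¹ = τ⁻¹ := by
    rw [hτ, mul_inv_rev, hπ1, hι1, ← mul_assoc]
    nth_rewrite 1 [← hπ1]
    rw [inv_mul_cancel, one_mul]
  have key : ∀ i : ℤ, π ((τ ^ i) e) = (τ ^ (-i)) e := by
    intro i
    have h : τ ^ (-i) = π * τ ^ i * π⁻¹ := by rw [← conj_zpow, hconj, inv_zpow, zpow_neg]
    rw [h, hπ1, Equiv.Perm.mul_apply, Equiv.Perm.mul_apply, he]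
  have keyι : ∀ i : ℤ, ι ((τ ^ i) e) = (τ ^ (-(i + 1))) e := by
    intro i
    rw [← key (i + 1), add_comm, zpow_add, zpow_one, Equiv.Perm.mul_apply]
    rw [hτ, Equiv.Perm.mul_apply, hπ]
  have hper : ∀ i j : ℤ, (τ ^ i) e = (τ ^ j) e ↔ (MulAction.period τ e : ℤ) ∣ i - j := by
    intro i j
    rw [← MulAction.zpow_smul_eq_iff_period_dvd, Equiv.Perm.smul_def, sub_eq_neg_add, zpow_add,
      Equiv.Perm.mul_apply, zpow_neg, Equiv.Perm.inv_eq_iff_eq]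
  have hpos : 0 < MulAction.period τ e :=
    MulAction.period_pos_of_orderOf_pos (orderOf_pos τ) e
  set n := MulAction.period τ e with hn
  refine ⟨?_, ?_⟩
  · rintro d ⟨i, rfl⟩
    exact ⟨⟨_, (keyι i).symm⟩, ⟨_, (key i).symm⟩⟩
  -- Modulo n = 2j the reflection i ↦ -i fixes exactly 0 and j, so the mate is τ^j e. If n = 2j + 1,
  -- then i ↦ -(i + 1) fixes j, contradicting that `ι` has no fixed point.
  rcases Nat.even_or_odd' n with ⟨j, hj | hj⟩
  · refine ⟨(τ ^ (j : ℤ)) e, ?_, ⟨_, rfl⟩, ?_, ?_⟩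
    · intro h
      have h0 := (hper j 0).1 (by simpa using h)
      rw [sub_zero, Int.natCast_dvd_natCast] at h0
      have := Nat.le_of_dvd (by omega) h0
      omega
    · rw [key, hper]
      exact ⟨-1, by omega⟩
    · rintro d ⟨i, rfl⟩ hd
      rw [key, hper] at hd
      obtain ⟨q, hq⟩ := hd
      have hi : i = -(j * q) := by
        rw [hj] at hq; push_cast at hq; nlinarith
      rcases Int.even_or_odd' q with ⟨r, hr | hr⟩
      · left
        have := (hper i 0).2 ⟨-r, by rw [hi, hr, hj]; push_cast; ring⟩
        simpa using this
      · right
        exact (hper i j).2 ⟨-r - 1, by rw [hi, hr, hj]; push_cast; ring⟩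
  · exfalso
    refine hfix ((τ ^ (j : ℤ)) e) ?_
    rw [keyι, hper]
    exact ⟨-1, by omega⟩

end Involutions

/-- A maximal pairing of two disjoint finite sets, as an involution. -/
theorem exists_pairing {D : Type*} (A B : Finset D) (hAB : Disjoint A B) :
    ∃ p : D → D, (∀ d, p (p d) = d) ∧ (∀ d ∈ A, p d ∈ B ∨ p d = d) ∧
      (∀ d ∈ B, p d ∈ A ∨ p d = d) ∧ (∀ d, d ∉ A → d ∉ B → p d = d) ∧
      ((∀ d ∈ A, p d ≠ d) ∨ (∀ d ∈ B, p d ≠ d)) := by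
  wlog hle : #A ≤ #B generalizing A B
  · obtain ⟨p, h1, h2, h3, h4, h5⟩ := this B A hAB.symm (by omega)
    exact ⟨p, h1, h3, h2, fun d ha hb => h4 d hb ha, h5.symm⟩
  induction A using Finset.induction_on generalizing B with
  | empty => exact ⟨id, by simp⟩
  | insert x A hx ih =>
    rw [card_insert_of_notMem hx] at hle
    obtain ⟨y, hy⟩ : B.Nonempty := card_pos.1 (by omega)
    rw [disjoint_insert_left] at hAB
    have hxy : x ≠ y := fun h => hAB.1 (h ▸ hy)
    have hyA : y ∉ A := fun h => disjoint_left.1 hAB.2 h hy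
    obtain ⟨p, h1, h2, h3, h4, h5⟩ := ih (B.erase y)
      (hAB.2.mono_right (erase_subset _ _)) (by rw [card_erase_of_mem hy]; omega)
    have hpx : p x = x := h4 x hx (fun h => hAB.1 (mem_of_mem_erase h))
    have hpy : p y = y := h4 y hyA (notMem_erase _ _)
    refine ⟨fun d => if d = x then y else if d = y then x else p d, ?_, ?_, ?_, ?_, ?_⟩
    · intro d
      by_cases hd : d = x
      · simp [hd, hxy.symm]
      by_cases hd' : d = y
      · simp [hd', hxy.symm]
      have e1 : p d ≠ x := fun h => hd (by rw [← h1 d, h, hpx])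
      have e2 : p d ≠ y := fun h => hd' (by rw [← h1 d, h, hpy])
      simp [hd, hd', e1, e2, h1]
    · intro d hd
      by_cases hdx : d = x
      · simp [hdx, hy]
      have hdA : d ∈ A := by simpa [hdx] using hd
      have hdy : d ≠ y := fun h => hyA (h ▸ hdA)
      simp only [hdx, hdy, if_false]
      exact (h2 d hdA).imp_left mem_of_mem_erase
    · intro d hd
      have hdx : d ≠ x := fun h => hAB.1 (h ▸ hd)
      by_cases hdy : d = y
      · simp [hdy, hxy.symm]
      simp only [hdx, hdy, if_false]
      exact (h3 d (mem_erase.2 ⟨hdy, hd⟩)).imp_left (mem_insert_of_mem)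
    · intro d hdA hdB
      have hdx : d ≠ x := fun h => hdA (h ▸ mem_insert_self _ _)
      have hdy : d ≠ y := fun h => hdB (h ▸ hy)
      simp only [hdx, hdy, if_false]
      exact h4 d (fun h => hdA (mem_insert_of_mem h)) (fun h => hdB (mem_of_mem_erase h))
    · refine h5.elim (fun h => Or.inl fun d hd => ?_) (fun h => ?_)
      · by_cases hdx : d = x
        · simpa [hdx] using hxy.symm
        have hdA : d ∈ A := by simpa [hdx] using hd
        have hdy : d ≠ y := fun h => hyA (h ▸ hdA)
        simpa only [hdx, hdy, if_false] using h d hdA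
      · right
        intro d hd
        have hdx : d ≠ x := fun h => hAB.1 (h ▸ hd)
        by_cases hdy : d = y
        · simpa [hdy, hxy.symm] using hxy
        simpa only [hdx, hdy, if_false] using h d (mem_erase.2 ⟨hdy, hd⟩)

/-! ### Color counts, two-colored subgraphs and Kempe exchanges. -/

section Counting

variable {V : Type*} [Fintype V] {α : Type*}

/-- The number of edges of color `a` at the vertex `v`. -/
noncomputable def cnt (G : SimpleGraph V) (c : Sym2 V → α) (v : V) (a : α) : ℕ :=
  #{w | G.Adj v w ∧ c s(v, w) = a}

/-- The degree of `v`. -/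
noncomputable def deg (G : SimpleGraph V) (v : V) : ℕ := #{w | G.Adj v w}

/-- `c` restricts to an `f`-coloring of `G`. -/
def Good (G : SimpleGraph V) (f : V → ℕ) (c : Sym2 V → α) : Prop := ∀ v a, cnt G c v a ≤ f v

theorem deg_eq_sum_cnt [Fintype α] (G : SimpleGraph V) (c : Sym2 V → α) (v : V) :
    deg G v = ∑ a, cnt G c v a := by
  unfold deg cnt
  rw [card_eq_sum_card_fiberwise (f := fun w => c s(v, w)) (t := univ) (by simp)]
  simp only [filter_filter]

theorem cnt_le_card {G : SimpleGraph V} {c : Sym2 V → α} {v : V} {q : α} {A : Finset V}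
    (h : ∀ w, G.Adj v w → c s(v, w) = q → w ∈ A) : cnt G c v q ≤ #A :=
  card_le_card fun w hw => h w (mem_filter.1 hw).2.1 (mem_filter.1 hw).2.2

theorem cnt_le_cnt_of_injOn {β : Type*} {G G' : SimpleGraph V} {c : Sym2 V → α} {c' : Sym2 V → β}
    {v v' : V} {q : α} {q' : β} (φ : V → V)
    (h : ∀ w, G.Adj v w → c s(v, w) = q → G'.Adj v' (φ w) ∧ c' s(v', φ w) = q')
    (hφ : ∀ w w', G.Adj v w → G.Adj v w' → φ w = φ w' → w = w') :
    cnt G c v q ≤ cnt G' c' v' q' := by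
  refine card_le_card_of_injOn φ (fun w hw => ?_) (fun w hw w' hw' hww' => ?_)
  · have := (mem_filter.1 hw).2
    exact mem_filter.2 ⟨mem_univ _, h w this.1 this.2⟩
  · exact hφ w w' (mem_filter.1 hw).2.1 (mem_filter.1 hw').2.1 hww'

theorem eq_of_cnt_le_one {G : SimpleGraph V} {c : Sym2 V → α} {v w w' : V} {q : α}
    (h : cnt G c v q ≤ 1) (hw : G.Adj v w) (hq : c s(v, w) = q) (hw' : G.Adj v w')
    (hq' : c s(v, w') = q) : w = w' :=
  card_le_one.1 h w (mem_filter.2 ⟨mem_univ _, hw, hq⟩) w' (mem_filter.2 ⟨mem_univ _, hw', hq'⟩)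

theorem deg_le_card {G : SimpleGraph V} {v : V} {A : Finset V} (h : ∀ w, G.Adj v w → w ∈ A) :
    deg G v ≤ #A :=
  card_le_card fun w hw => h w (mem_filter.1 hw).2

theorem deg_mono {G H : SimpleGraph V} (h : H ≤ G) (v : V) : deg H v ≤ deg G v :=
  card_le_card (monotone_filter_right _ fun _ _ hw => h hw)

theorem deg_lt_deg {G H : SimpleGraph V} (h : H ≤ G) {v w : V} (h1 : G.Adj v w)
    (h2 : ¬ H.Adj v w) : deg H v < deg G v :=
  card_lt_card (ssubset_iff_of_subset (monotone_filter_right _ fun _ _ hw => h hw) |>.2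
    ⟨w, mem_filter.2 ⟨mem_univ _, h1⟩, fun hw => h2 (mem_filter.1 hw).2⟩)

/-- The subgraph of the edges with color `a` or `b`. -/
def twoColorGraph (G : SimpleGraph V) (c : Sym2 V → α) (a b : α) : SimpleGraph V where
  Adj v w := G.Adj v w ∧ (c s(v, w) = a ∨ c s(v, w) = b)
  symm := ⟨fun v w h => by rw [Sym2.eq_swap]; exact ⟨h.1.symm, h.2⟩⟩
  loopless := ⟨fun v h => G.loopless.irrefl v h.1⟩

variable (G : SimpleGraph V) (c : Sym2 V → α) (a b : α)

theorem twoColorGraph_dart_color {G : SimpleGraph V} {c : Sym2 V → α} {a b : α}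
    (d : (twoColorGraph G c a b).Dart) : c d.edge = a ∨ c d.edge = b := d.adj.2

theorem cnt_eq_card_dart (c' : Sym2 V → α) (v : V) (q : α)
    (hq : ∀ e, c' e = q → c e = a ∨ c e = b) :
    cnt G c' v q = #{d : (twoColorGraph G c a b).Dart | d.fst = v ∧ c' d.edge = q} := by
  symm
  refine card_bij (fun d _ => d.snd) ?_ ?_ ?_
  · rintro d hd
    obtain ⟨rfl, h⟩ := (mem_filter.1 hd).2
    exact mem_filter.2 ⟨mem_univ _, d.adj.1, h⟩
  · intro d hd d' hd' h
    refine SimpleGraph.Dart.ext _ _ (Prod.ext ?_ h)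
    exact (mem_filter.1 hd).2.1.trans (mem_filter.1 hd').2.1.symm
  · intro w hw
    obtain ⟨h1, h2⟩ := (mem_filter.1 hw).2
    exact ⟨⟨(v, w), h1, hq _ h2⟩, mem_filter.2 ⟨mem_univ _, rfl, h2⟩, rfl⟩

/-- The coloring obtained by exchanging `a` and `b` on the edges underlying the darts in `K`. -/
noncomputable def exchange (K : Set (twoColorGraph G c a b).Dart) : Sym2 V → α :=
  fun e => if ∃ d ∈ K, d.edge = e then Equiv.swap a b (c e) else c e

variable {G c a b} {K : Set (twoColorGraph G c a b).Dart}

theorem exchange_edge_of_mem {d : (twoColorGraph G c a b).Dart} (hd : d ∈ K) :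
    exchange G c a b K d.edge = Equiv.swap a b (c d.edge) :=
  if_pos ⟨d, hd, rfl⟩

theorem exchange_edge_of_notMem (hK : ∀ d ∈ K, d.symm ∈ K)
    {d : (twoColorGraph G c a b).Dart} (hd : d ∉ K) :
    exchange G c a b K d.edge = c d.edge := by
  refine if_neg ?_
  rintro ⟨d', hd', h⟩
  rcases (SimpleGraph.dart_edge_eq_iff d' d).1 h with h | h
  · exact hd (h ▸ hd')
  · exact hd (by simpa [h] using hK _ hd')

theorem exchange_eq_of_ne {e : Sym2 V} (h : c e ≠ a ∧ c e ≠ b) :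
    exchange G c a b K e = c e := by
  unfold exchange
  split_ifs
  · exact Equiv.swap_apply_of_ne_of_ne h.1 h.2
  · rfl

theorem exchange_mem_iff (e : Sym2 V) :
    (exchange G c a b K e = a ∨ exchange G c a b K e = b) ↔ (c e = a ∨ c e = b) := by
  unfold exchange
  split_ifs
  · by_cases h1 : c e = a
    · simp [h1]
    by_cases h2 : c e = b
    · simp [h2]
    rw [Equiv.swap_apply_of_ne_of_ne h1 h2]
  · rfl

theorem cnt_exchange_of_ne {q : α} (v : V) (hq : q ≠ a ∧ q ≠ b) :
    cnt G (exchange G c a b K) v q = cnt G c v q := by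
  unfold cnt
  congr 1
  ext w
  simp only [mem_filter, mem_univ, true_and, and_congr_right_iff]
  intro _
  constructor
  · intro h
    by_cases h' : c s(v, w) = a ∨ c s(v, w) = b
    · rw [← exchange_mem_iff (K := K), h] at h'
      exact absurd h' (by simp [hq])
    · rw [not_or] at h'
      rwa [exchange_eq_of_ne h'] at h
  · rintro rfl
    exact exchange_eq_of_ne hq

theorem cnt_exchange_eq_card_dart {q : α} (v : V) (hq : q = a ∨ q = b) :
    cnt G (exchange G c a b K) v q =
      #{d : (twoColorGraph G c a b).Dart | d.fst = v ∧ exchange G c a b K d.edge = q} := by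
  refine cnt_eq_card_dart G c a b _ v q fun e he => ?_
  rw [← exchange_mem_iff (K := K), he]
  exact hq

theorem cnt_eq_card_dart_self {q : α} (v : V) (hq : q = a ∨ q = b) :
    cnt G c v q = #{d : (twoColorGraph G c a b).Dart | d.fst = v ∧ c d.edge = q} := by
  refine cnt_eq_card_dart G c a b _ v q fun e he => ?_
  rwa [he]

/-- If the darts of color `r` at `v` are paired with darts of the other color, then the
number of edges of either color at `v` after the exchange is at most the number of edges of the
other color before. -/
theorem cnt_exchange_le_of_paired (hab : a ≠ b) (hK : ∀ d ∈ K, d.symm ∈ K) {v : V} {q r : α}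
    (hq : q = a ∨ q = b) (hr : r = a ∨ r = b) (g : Equiv.Perm (twoColorGraph G c a b).Dart)
    (hg : ∀ d, d.fst = v → c d.edge = r →
      (g d).fst = v ∧ c (g d).edge = Equiv.swap a b r ∧ (g d ∈ K ↔ d ∈ K))
    (E : Finset (twoColorGraph G c a b).Dart)
    (hE : ∀ d ∈ E, d.fst = v ∧ c d.edge = Equiv.swap a b r ∧
      exchange G c a b K d.edge ≠ q ∧ ∀ d', d'.fst = v → c d'.edge = r → g d' ≠ d) :
    cnt G (exchange G c a b K) v q + #E ≤ cnt G c v (Equiv.swap a b r) := by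
  have hr' : Equiv.swap a b r = a ∨ Equiv.swap a b r = b := by rcases hr with rfl | rfl <;> simp
  have hrr : r ≠ Equiv.swap a b r := by rcases hr with rfl | rfl <;> simp [hab, hab.symm]
  have hcol : ∀ d : (twoColorGraph G c a b).Dart, c d.edge = r ∨ c d.edge = Equiv.swap a b r := by
    intro d
    have := twoColorGraph_dart_color d
    rcases hr with rfl | rfl <;> simp <;> tauto
  rw [cnt_exchange_eq_card_dart v hq, cnt_eq_card_dart_self v hr']
  set A : Finset (twoColorGraph G c a b).Dart :=
    {d | d.fst = v ∧ exchange G c a b K d.edge = q} with hA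
  -- Darts that had color `r` are replaced by their partners. Partners lie both in `K` or both
  -- outside it, so their new colors differ and no dart is hit twice. The darts in `E` are partners
  -- of nothing and do not receive `q`, so they are missed and give the extra slack.
  set φ : (twoColorGraph G c a b).Dart → (twoColorGraph G c a b).Dart :=
    fun d => if c d.edge = r then g d else d with hφ
  have hinj : Set.InjOn φ A := by
    have key : ∀ d d', d ∈ A → d' ∈ A → c d.edge = r → c d'.edge ≠ r → g d ≠ d' := by
      rintro d d' hd hd' h h' rfl
      obtain ⟨-, h1, h2⟩ := (mem_filter.1 hd)
      obtain ⟨-, h3, h4⟩ := (mem_filter.1 hd')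
      obtain ⟨-, h5, h6⟩ := hg d h1 h
      by_cases hdK : d ∈ K
      · rw [exchange_edge_of_mem hdK, h] at h2
        rw [exchange_edge_of_mem (h6.2 hdK), h5, ← h2] at h4
        exact hrr ((Equiv.swap a b).injective h4.symm)
      · rw [exchange_edge_of_notMem hK hdK, h] at h2
        rw [exchange_edge_of_notMem hK (fun h => hdK (h6.1 h)), h5, ← h2] at h4
        exact hrr h4.symm
    intro d hd d' hd' h
    simp only [hφ] at h
    split_ifs at h with h1 h2 h2
    · exact g.injective h
    · exact absurd h (key d d' hd hd' h1 h2)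
    · exact absurd h.symm (key d' d hd' hd h2 h1)
    · exact h
  have hdisj : Disjoint (A.image φ) E := by
    rw [disjoint_left]
    intro x hx hdE
    obtain ⟨d, hd, rfl⟩ := mem_image.1 hx
    obtain ⟨-, -, h1, h2⟩ := hE _ hdE
    have hd1 := (mem_filter.1 hd).2
    by_cases h : c d.edge = r
    · exact h2 d hd1.1 h (by simp [hφ, h])
    · exact h1 (by simpa [hφ, h] using hd1.2)
  rw [← card_image_of_injOn hinj, ← card_union_of_disjoint hdisj]
  refine card_le_card (union_subset ?_ ?_)
  · intro x hx
    obtain ⟨d, hd, rfl⟩ := mem_image.1 hx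
    have hd1 := (mem_filter.1 hd).2
    by_cases h : c d.edge = r
    · have := hg d hd1.1 h
      simp [hφ, h, this]
    · simpa only [hφ, h, if_false, mem_filter, mem_univ, true_and] using
        And.intro hd1.1 ((hcol d).resolve_left h)
  · intro d hd
    have := hE d hd
    simp [this]

/-- If the darts of `K` at `v` are paired up among themselves with darts of the other color, then
the exchange does not increase the number of edges of any color at `v`. -/
theorem cnt_exchange_le_of_paired_mem (hK : ∀ d ∈ K, d.symm ∈ K) {v : V} (q : α)
    (g : Equiv.Perm (twoColorGraph G c a b).Dart)
    (hg : ∀ d ∈ K, d.fst = v →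
      (g d).fst = v ∧ c (g d).edge = Equiv.swap a b (c d.edge) ∧ g d ∈ K) :
    cnt G (exchange G c a b K) v q ≤ cnt G c v q := by
  by_cases hq : q = a ∨ q = b
  swap
  · exact (cnt_exchange_of_ne v (not_or.1 hq)).le
  rw [cnt_exchange_eq_card_dart v hq, cnt_eq_card_dart_self v hq]
  refine card_le_card_of_injOn (fun d => if d ∈ K then g d else d) ?_ ?_
  · intro d hd
    have hd1 := (mem_filter.1 hd).2
    by_cases h : d ∈ K
    · obtain ⟨h1, h2, -⟩ := hg d h hd1.1
      have h3 := hd1.2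
      rw [exchange_edge_of_mem h] at h3
      simp [h, h1, h2, h3]
    · have h3 := hd1.2
      rw [exchange_edge_of_notMem hK h] at h3
      simp [h, h3, hd1.1]
  · intro d hd d' hd' h
    have hd1 := (mem_filter.1 hd).2
    have hd1' := (mem_filter.1 hd').2
    dsimp only at h
    split_ifs at h with h1 h2 h2
    · exact g.injective h
    · exact absurd (h ▸ (hg d h1 hd1.1).2.2) h2
    · exact absurd (h ▸ (hg d' h2 hd1'.1).2.2) h1
    · exact h

variable (G c a b) in
/-- A pairing of the darts at each vertex other than `x`, each pair consisting of one
dart of color `a` and one of color `b`, with as many pairs as possible. -/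
theorem exists_dart_pairing (hab : a ≠ b) (x : V) :
    ∃ π : Equiv.Perm (twoColorGraph G c a b).Dart, (∀ d, π (π d) = d) ∧ (∀ d, (π d).fst = d.fst) ∧
      (∀ d, π d ≠ d → c (π d).edge = Equiv.swap a b (c d.edge)) ∧
      (∀ d, d.fst = x → π d = d) ∧
      (∀ v, v ≠ x → (∀ d, d.fst = v → c d.edge = a → π d ≠ d) ∨
        (∀ d, d.fst = v → c d.edge = b → π d ≠ d)) := by
  have := fun v => exists_pairing
    (univ.filter fun d : (twoColorGraph G c a b).Dart => d.fst = v ∧ c d.edge = a)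
    (univ.filter fun d : (twoColorGraph G c a b).Dart => d.fst = v ∧ c d.edge = b)
    (by rw [disjoint_left]
        intro d h1 h2
        exact hab ((mem_filter.1 h1).2.2.symm.trans (mem_filter.1 h2).2.2))
  simp only [mem_filter, mem_univ, true_and, and_imp, not_and] at this
  choose p h1 h2 h3 h4 h5 using this
  have hfst : ∀ v d, d.fst = v → (p v d).fst = v := by
    intro v d hd
    rcases twoColorGraph_dart_color d with h | h
    · exact (h2 v d hd h).elim (·.1) (fun h => by rw [h, hd])
    · exact (h3 v d hd h).elim (·.1) (fun h => by rw [h, hd])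
  let π : (twoColorGraph G c a b).Dart → (twoColorGraph G c a b).Dart :=
    fun d => if d.fst = x then d else p d.fst d
  have hπx : ∀ d, d.fst = x → π d = d := fun d h => if_pos h
  have hπ : ∀ d, d.fst ≠ x → π d = p d.fst d := fun d h => if_neg h
  have hπf : ∀ d, (π d).fst = d.fst := by
    intro d
    by_cases h : d.fst = x
    · rw [hπx d h]
    · rw [hπ d h, hfst _ d rfl]
  have hinv : Function.Involutive π := by
    intro d
    by_cases h : d.fst = x
    · rw [hπx d h, hπx d h]
    · rw [hπ (π d) (by rwa [hπf]), hπf, hπ d h, h1]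
  refine ⟨hinv.toPerm, hinv, hπf, ?_, hπx, ?_⟩
  · intro d hd
    change π d ≠ d at hd
    change c (π d).edge = _
    have h : d.fst ≠ x := fun h => hd (hπx d h)
    rw [hπ d h] at hd ⊢
    rcases twoColorGraph_dart_color d with h' | h'
    · rw [((h2 _ d rfl h').resolve_right hd).2, h', Equiv.swap_apply_left]
    · rw [((h3 _ d rfl h').resolve_right hd).2, h', Equiv.swap_apply_right]
  · intro v hv
    refine (h5 v).imp (fun h d hd hc => ?_) (fun h d hd hc => ?_)
    all_goals
      change π d ≠ d
      rw [hπ d (by rwa [hd]), hd]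
      exact h d hd hc

end Counting

/-! ### Vizing fans and shifting colors along them. -/

section Fan

variable {V : Type*} [Fintype V] {α : Type*}

theorem cnt_update_le {G H : SimpleGraph V} {x y : V}
    (hGH : ∀ v w, G.Adj v w → s(v, w) ≠ s(x, y) → H.Adj v w) (c : Sym2 V → α) (a : α)
    (v : V) (q : α) :
    cnt G (Function.update c s(x, y) a) v q ≤
      cnt H c v q + if q = a ∧ (v = x ∨ v = y) then 1 else 0 := by
  have h1 : #{w | s(v, w) = s(x, y) ∧ q = a} ≤ if q = a ∧ (v = x ∨ v = y) then 1 else 0 := by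
    split_ifs with h
    · rw [card_le_one]
      intro w hw w' hw'
      have := (mem_filter.1 hw).2.1.trans (mem_filter.1 hw').2.1.symm
      exact Sym2.congr_right.1 this
    · rw [nonpos_iff_eq_zero, card_eq_zero, filter_eq_empty_iff]
      rintro w - ⟨h1, h2⟩
      refine h ⟨h2, ?_⟩
      have : v ∈ s(x, y) := h1 ▸ Sym2.mem_mk_left v w
      simpa using this
  refine le_trans ?_ (Nat.add_le_add_left h1 _)
  refine le_trans (card_le_card ?_) (card_union_le _ _)
  intro w hw
  obtain ⟨h1, h2⟩ := (mem_filter.1 hw).2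
  by_cases h : s(v, w) = s(x, y)
  · rw [h, Function.update_self] at h2
    exact mem_union_right _ (mem_filter.2 ⟨mem_univ _, h, h2.symm⟩)
  · rw [Function.update_of_ne h] at h2
    exact mem_union_left _ (mem_filter.2 ⟨mem_univ _, hGH _ _ h1 h, h2⟩)

theorem cnt_update_lt {H : SimpleGraph V} {x t : V} (hxt : H.Adj x t) (c : Sym2 V → α) {a : α}
    (ha : c s(x, t) ≠ a) :
    cnt H (Function.update c s(x, t) a) x (c s(x, t)) < cnt H c x (c s(x, t)) := by
  refine card_lt_card (ssubset_iff_of_subset ?_ |>.2 ⟨t, ?_, ?_⟩)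
  · intro w hw
    obtain ⟨h1, h2⟩ := (mem_filter.1 hw).2
    by_cases h : s(x, w) = s(x, t)
    · rw [h, Function.update_self] at h2
      exact absurd h2.symm ha
    · rw [Function.update_of_ne h] at h2
      exact mem_filter.2 ⟨mem_univ _, h1, h2⟩
  · exact mem_filter.2 ⟨mem_univ _, hxt, rfl⟩
  · intro h
    have := (mem_filter.1 h).2.2
    rw [Function.update_self] at this
    exact ha this.symm

/-- In a fan at `x`, the vertex `t` may follow the vertex `s` if `s` misses the color of `xt`. -/
def FanStep (H : SimpleGraph V) (f : V → ℕ) (c : Sym2 V → α) (x s t : V) : Prop :=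
  H.Adj x t ∧ cnt H c s (c s(x, t)) < f s

variable {G H : SimpleGraph V} {f : V → ℕ} {x y : V}

/-- Recoloring the last fan edge with `a` frees its old color at `x`, and the preceding fan vertex
misses that color. This gives a shorter path of the same kind; at length zero the edge `xy` itself
receives the free color. -/
theorem exists_good_of_fan_path (hxy : x ≠ y)
    (hGH : ∀ v w, G.Adj v w → s(v, w) ≠ s(x, y) → H.Adj v w) (n : ℕ) :
    ∀ (c : Sym2 V → α) (a : α) (Y : ℕ → V), Good H f c → cnt H c x a < f x → Y 0 = y →
      (∀ i < n, FanStep H f c x (Y i) (Y (i + 1))) → cnt H c (Y n) a < f (Y n) →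
      ∃ c' : Sym2 V → α, Good G f c' := by
  induction n using Nat.strong_induction_on with
  | _ n ih =>
  intro c a Y hc hx h0 hstep hn
  rcases n with - | n
  · refine ⟨Function.update c s(x, y) a, fun v q => (cnt_update_le hGH c a v q).trans ?_⟩
    split_ifs with h
    · obtain ⟨rfl, rfl | rfl⟩ := h
      · exact hx
      · rw [h0] at hn
        exact hn
    · exact hc v q
  -- If the last vertex occurs earlier, the path can be cut there. Otherwise recoloring its edge
  -- raises no count at the earlier fan vertices, so their steps survive.
  by_cases hrep : ∃ i, i < n + 1 ∧ Y i = Y (n + 1)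
  · obtain ⟨i, hi, h⟩ := hrep
    exact ih i hi c a Y hc hx h0 (fun j hj => hstep j (hj.trans hi)) (h ▸ hn)
  push Not at hrep
  obtain ⟨hadj, hlt⟩ := hstep n n.lt_succ_self
  set t := Y (n + 1) with ht
  by_cases hγ : c s(x, t) = a
  · exact ih n n.lt_succ_self c a Y hc hx h0 (fun j hj => hstep j (by omega)) (hγ ▸ hlt)
  have hYx : ∀ i, i ≤ n → Y i ≠ x := by
    intro i hi
    rcases i with - | i
    · rw [h0]; exact hxy.symm
    · exact (hstep i (by omega)).1.ne'
  have hle : ∀ v q, cnt H (Function.update c s(x, t) a) v q ≤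
      cnt H c v q + if q = a ∧ (v = x ∨ v = t) then 1 else 0 :=
    cnt_update_le (fun _ _ h _ => h) c a
  have hY : ∀ i, i ≤ n → ∀ q, cnt H (Function.update c s(x, t) a) (Y i) q ≤ cnt H c (Y i) q := by
    intro i hi q
    refine (hle _ _).trans ?_
    rw [if_neg]
    · rfl
    · rintro ⟨-, h | h⟩
      · exact hYx i hi h
      · exact hrep i (by omega) h
  refine ih n n.lt_succ_self (Function.update c s(x, t) a) (c s(x, t)) Y ?_ ?_ h0 ?_ ?_
  · intro v q
    refine (hle v q).trans ?_
    split_ifs with h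
    · obtain ⟨rfl, rfl | rfl⟩ := h
      · exact hx
      · exact hn
    · exact hc v q
  · exact (cnt_update_lt hadj c hγ).trans_le (hc _ _)
  · intro i hi
    obtain ⟨h1, h2⟩ := hstep i (by omega)
    refine ⟨h1, ?_⟩
    rw [Function.update_of_ne]
    · exact (hY i hi.le _).trans_lt h2
    · intro h
      exact hrep (i + 1) (by omega) (Sym2.congr_right.1 h)
  · exact (hY n le_rfl _).trans_lt hlt

theorem exists_path_of_reflTransGen {β : Type*} {r : β → β → Prop} {s t : β}
    (h : Relation.ReflTransGen r s t) :
    ∃ (n : ℕ) (Y : ℕ → β), Y 0 = s ∧ Y n = t ∧ ∀ i < n, r (Y i) (Y (i + 1)) := by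
  induction h with
  | refl => exact ⟨0, fun _ => s, rfl, rfl, fun i hi => absurd hi (Nat.not_lt_zero i)⟩
  | @tail u v _ huv ih =>
    obtain ⟨n, Y, h0, hn, h⟩ := ih
    refine ⟨n + 1, fun i => if i ≤ n then Y i else v, by simp [h0], by simp, fun i hi => ?_⟩
    rcases Nat.lt_succ_iff_lt_or_eq.1 hi with hi | rfl
    · simpa [hi.le, Nat.succ_le_iff.2 hi] using h i hi
    · simpa [hn] using huv

/-- A vertex of the fan and its centre miss no common color. -/
theorem exists_good_of_fan (hxy : x ≠ y)
    (hGH : ∀ v w, G.Adj v w → s(v, w) ≠ s(x, y) → H.Adj v w) {c : Sym2 V → α} {a : α}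
    (hc : Good H f c) (hx : cnt H c x a < f x) {t : V}
    (ht : Relation.ReflTransGen (FanStep H f c x) y t) (hta : cnt H c t a < f t) :
    ∃ c' : Sym2 V → α, Good G f c' := by
  obtain ⟨n, Y, h0, hn, h⟩ := exists_path_of_reflTransGen ht
  exact exists_good_of_fan_path hxy hGH n c a Y hc hx h0 h (hn ▸ hta)

theorem reflTransGen_mono_of_reachable {β : Type*} {r r' : β → β → Prop} {s t : β}
    (h : Relation.ReflTransGen r s t)
    (hr : ∀ u v, Relation.ReflTransGen r s u → r u v → r' u v) :
    Relation.ReflTransGen r' s t := by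
  induction h with
  | refl => exact .refl
  | tail hu huv ih => exact ih.tail (hr _ _ hu huv)

/-- Following a fan in a modified coloring. -/
theorem fan_transport {c c' : Sym2 V → α} {a : α} {s t : V}
    (hst : Relation.ReflTransGen (fun u v => FanStep H f c x u v ∧ c' s(x, v) = c s(x, v)) s t)
    (hs : Relation.ReflTransGen (FanStep H f c' x) y s)
    (hP : ∀ v, Relation.ReflTransGen (FanStep H f c x) s v →
      (∀ q, cnt H c' v q ≤ cnt H c v q) ∨ cnt H c' v a < f v) :
    (∃ v, Relation.ReflTransGen (FanStep H f c' x) y v ∧ cnt H c' v a < f v) ∨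
      Relation.ReflTransGen (FanStep H f c' x) y t := by
  induction hst with
  | refl => exact Or.inr hs
  | @tail u v hu huv ih =>
    refine ih.elim Or.inl fun hyu => ?_
    have hsu : Relation.ReflTransGen (FanStep H f c x) s u := reflTransGen_mono_of_reachable hu fun _ _ _ h => h.1
    rcases hP u hsu with h | h
    · refine Or.inr (hyu.tail ⟨huv.1.1, ?_⟩)
      rw [huv.2]
      exact (h _).trans_lt huv.1.2
    · exact Or.inl ⟨u, hyu, h⟩

/-- Every vertex of a fan is reached by a path using at most one edge of color `b`. -/
theorem fan_path_one_color {c : Sym2 V → α} (b : α) {t : V}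
    (ht : Relation.ReflTransGen (FanStep H f c x) y t) :
    Relation.ReflTransGen (fun u v => FanStep H f c x u v ∧ c s(x, v) ≠ b) y t ∨
    ∃ s z, Relation.ReflTransGen (fun u v => FanStep H f c x u v ∧ c s(x, v) ≠ b) y s ∧
      FanStep H f c x s z ∧ c s(x, z) = b ∧
      Relation.ReflTransGen (fun u v => FanStep H f c x u v ∧ c s(x, v) ≠ b) z t := by
  induction ht with
  | refl => exact Or.inl .refl
  | @tail u v hu huv ih =>
    by_cases hb : c s(x, v) = b
    · right
      rcases ih with h | ⟨s, z, h1, h2, h3, -⟩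
      · exact ⟨u, v, h, huv, hb, .refl⟩
      · exact ⟨s, v, h1, ⟨huv.1, by rw [hb, ← h3]; exact h2.2⟩, hb, .refl⟩
    · rcases ih with h | ⟨s, z, h1, h2, h3, h4⟩
      · exact Or.inl (h.tail ⟨huv, hb⟩)
      · exact Or.inr ⟨s, z, h1, h2, h3, h4.tail ⟨huv, hb⟩⟩

end Fan

/-! ### How often the fan vertices can miss a given color. -/

section SlotBound

variable {V : Type*} [Fintype V] {α : Type*} {G H : SimpleGraph V} {f : V → ℕ} {x y : V}

/-- A Kempe exchange on a set `K` of darts that is closed under the pairing `π` and changes no count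
at `x`: if it meets an unpaired dart at a fan vertex, reached by a fan path that is not affected,
then the uncolored edge can be colored. -/
theorem exists_good_of_exchange (hxy : x ≠ y)
    (hGH : ∀ v w, G.Adj v w → s(v, w) ≠ s(x, y) → H.Adj v w) {c : Sym2 V → α} {a b : α}
    (hab : a ≠ b) (hc : Good H f c) (hx : cnt H c x a < f x)
    (π : Equiv.Perm (twoColorGraph H c a b).Dart) (hπ : ∀ d, π (π d) = d)
    (hπf : ∀ d, (π d).fst = d.fst)
    (hπc : ∀ d, π d ≠ d → c (π d).edge = Equiv.swap a b (c d.edge))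
    (hπm : ∀ v, v ≠ x → (∀ d, d.fst = v → c d.edge = a → π d ≠ d) ∨
      (∀ d, d.fst = v → c d.edge = b → π d ≠ d))
    (hTa : ∀ v, Relation.ReflTransGen (FanStep H f c x) y v → f v ≤ cnt H c v a)
    (hTπ : ∀ v, Relation.ReflTransGen (FanStep H f c x) y v →
      ∀ d, d.fst = v → c d.edge = b → π d ≠ d)
    (K : Set (twoColorGraph H c a b).Dart) (hK : ∀ d ∈ K, d.symm ∈ K) (hKπ : ∀ d ∈ K, π d ∈ K)
    (hKx : ∀ q, cnt H (exchange H c a b K) x q ≤ cnt H c x q)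
    (σ : (twoColorGraph H c a b).Dart) (hσK : σ ∈ K) (hσ : π σ = σ)
    (hp : Relation.ReflTransGen (fun u v => FanStep H f c x u v ∧ c s(x, v) ≠ b) y σ.fst ∨
      ∃ s z, Relation.ReflTransGen (fun u v => FanStep H f c x u v ∧ c s(x, v) ≠ b) y s ∧
        FanStep H f c x s z ∧ c s(x, z) = b ∧
        Relation.ReflTransGen (fun u v => FanStep H f c x u v ∧ c s(x, v) ≠ b) z σ.fst ∧
        exchange H c a b K s(x, z) = c s(x, z)) :
    ∃ c' : Sym2 V → α, Good G f c' := by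
  set c' := exchange H c a b K with hc'
  have hKπ' : ∀ d, π d ∈ K ↔ d ∈ K := fun d => ⟨fun h => hπ d ▸ hKπ _ h, hKπ d⟩
  have hTx : ∀ v, Relation.ReflTransGen (FanStep H f c x) y v → v ≠ x := by
    intro v hv
    rcases Relation.ReflTransGen.cases_tail hv with rfl | ⟨u, -, h⟩
    · exact hxy.symm
    · exact h.1.ne'
  have hpair : ∀ v r, (r = a ∨ r = b) → (∀ d, d.fst = v → c d.edge = r → π d ≠ d) →
      ∀ d, d.fst = v → c d.edge = r →
        (π d).fst = v ∧ c (π d).edge = Equiv.swap a b r ∧ (π d ∈ K ↔ d ∈ K) := by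
    intro v r hr h d hd hdr
    exact ⟨(hπf d).trans hd, hdr ▸ hπc d (h d hd hdr), hKπ' d⟩
  have hgood : Good H f c' := by
    intro v q
    by_cases hv : v = x
    · subst hv
      exact (hKx q).trans (hc _ _)
    by_cases hq : q = a ∨ q = b
    · rcases hπm v hv with h | h
      · have := cnt_exchange_le_of_paired hab hK hq (Or.inl rfl) π (hpair v a (Or.inl rfl) h) ∅
          (by simp)
        exact (Nat.le_add_right _ _).trans (this.trans (hc _ _))
      · have := cnt_exchange_le_of_paired hab hK hq (Or.inr rfl) π (hpair v b (Or.inr rfl) h) ∅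
          (by simp)
        exact (Nat.le_add_right _ _).trans (this.trans (hc _ _))
    · rw [hc', cnt_exchange_of_ne v (not_or.1 hq)]
      exact hc _ _
  -- All `b`-darts at a fan vertex are paired, so an unpaired dart there has color `a`. Exchanging
  -- it frees `a`; if no unpaired dart is exchanged, pairs merely trade colors and no count grows.
  have hT : ∀ v, Relation.ReflTransGen (FanStep H f c x) y v →
      ((∃ d ∈ K, d.fst = v ∧ π d = d) → cnt H c' v a < f v) ∧
      ((∀ q, cnt H c' v q ≤ cnt H c v q) ∨ cnt H c' v a < f v) := by
    intro v hv
    have h1 : (∃ d ∈ K, d.fst = v ∧ π d = d) → cnt H c' v a < f v := by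
      rintro ⟨d, hdK, hdv, hd⟩
      have hda : c d.edge = a :=
        (twoColorGraph_dart_color d).resolve_right fun h => hTπ v hv d hdv h hd
      have := cnt_exchange_le_of_paired hab hK (Or.inl rfl) (Or.inr rfl) π
        (hpair v b (Or.inr rfl) (hTπ v hv)) {d} (by
          simp only [mem_singleton, forall_eq, Equiv.swap_apply_right]
          refine ⟨hdv, hda, ?_, ?_⟩
          · rw [exchange_edge_of_mem hdK, hda, Equiv.swap_apply_left]
            exact hab.symm
          · intro d' hd'v hd' h
            have : d' = d := π.injective (h.trans hd.symm)
            rw [this, hda] at hd'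
            exact hab hd')
      rw [card_singleton, Equiv.swap_apply_right] at this
      exact (Nat.lt_of_succ_le this).trans_le (hc _ _)
    refine ⟨h1, ?_⟩
    by_cases h : ∃ d ∈ K, d.fst = v ∧ π d = d
    · exact Or.inr (h1 h)
    · push Not at h
      refine Or.inl fun q => cnt_exchange_le_of_paired_mem hK q π fun d hd hdv => ?_
      exact ⟨(hπf d).trans hdv, hπc d (h d hd hdv), hKπ d hd⟩
  -- No fan step uses color `a`, because `a` is saturated at all fan vertices. A step not using `b`
  -- either is therefore unaffected by the exchange.
  have hmono : ∀ s t, Relation.ReflTransGen (FanStep H f c x) y s →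
      Relation.ReflTransGen (fun u v => FanStep H f c x u v ∧ c s(x, v) ≠ b) s t →
      Relation.ReflTransGen (fun u v => FanStep H f c x u v ∧ c' s(x, v) = c s(x, v)) s t := by
    intro s t hs hst
    refine reflTransGen_mono_of_reachable hst fun u v hu huv => ⟨huv.1, ?_⟩
    have hu' : Relation.ReflTransGen (FanStep H f c x) y u :=
      hs.trans (reflTransGen_mono_of_reachable hu fun _ _ _ h => h.1)
    refine exchange_eq_of_ne ⟨fun h => ?_, huv.2⟩
    have := huv.1.2
    rw [h] at this
    exact absurd (hTa u hu') (not_le.2 this)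
  have hforget : ∀ s t,
      Relation.ReflTransGen (fun u v => FanStep H f c x u v ∧ c s(x, v) ≠ b) s t →
      Relation.ReflTransGen (FanStep H f c x) s t :=
    fun s t h => reflTransGen_mono_of_reachable h fun _ _ _ h => h.1
  have hreach : ∃ v, Relation.ReflTransGen (FanStep H f c' x) y v ∧ cnt H c' v a < f v := by
    rcases hp with hp | ⟨s, z, hs, hsz, hzb, hz, hzc⟩
    · have hy := hforget _ _ hp
      rcases fan_transport (hmono _ _ .refl hp) .refl (fun v hv => (hT v hv).2) with h | h
      · exact h
      · exact ⟨_, h, (hT _ hy).1 ⟨σ, hσK, rfl, hσ⟩⟩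
    · have hys := hforget _ _ hs
      rcases fan_transport (hmono _ _ .refl hs) .refl (fun v hv => (hT v hv).2) with h | h
      · exact h
      have hyz := hys.tail hsz
      rcases (hT s hys).2 with h1 | h1
      · have h2 : Relation.ReflTransGen (FanStep H f c' x) y z :=
          h.tail ⟨hsz.1, by rw [hzc]; exact (h1 _).trans_lt hsz.2⟩
        rcases fan_transport (hmono _ _ hyz hz) h2 (fun v hv => (hT v (hyz.trans hv)).2) with h | h
        · exact h
        · exact ⟨_, h, (hT _ (hyz.trans (hforget _ _ hz))).1 ⟨σ, hσK, rfl, hσ⟩⟩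
      · exact ⟨s, h, h1⟩
  obtain ⟨v, hv, hva⟩ := hreach
  exact exists_good_of_fan hxy hGH hgood ((hKx a).trans_lt hx) hv hva

/-- Each time a fan vertex misses `b`, it carries an unpaired `a`-dart, from which an `a`,`b`-chain
starts. A chain not ending at `x` can be exchanged by itself, freeing `a` at the fan vertex. Thus
all chains end at `x`, with distinct last darts. More than `f x` of them would force one ending in
`a` and two ending in `b`; exchanging the former with one of the latter keeps the counts at `x` and
again frees `a` in the fan. -/
theorem sum_missing_le (hxy : x ≠ y)
    (hGH : ∀ v w, G.Adj v w → s(v, w) ≠ s(x, y) → H.Adj v w) {c : Sym2 V → α} {a : α}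
    (hc : Good H f c) (hx : cnt H c x a < f x) (hG : ¬ ∃ c' : Sym2 V → α, Good G f c') (b : α) :
    ∑ t with Relation.ReflTransGen (FanStep H f c x) y t, (f t - cnt H c t b) ≤ f x := by
  have hTa : ∀ v, Relation.ReflTransGen (FanStep H f c x) y v → f v ≤ cnt H c v a := fun v hv =>
    not_lt.1 fun h => hG (exists_good_of_fan hxy hGH hc hx hv h)
  by_cases hab : a = b
  · subst hab
    refine (sum_eq_zero fun t ht => ?_).le.trans (Nat.zero_le _)
    exact Nat.sub_eq_zero_of_le (hTa t (mem_filter.1 ht).2)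
  have hTx : ∀ v, Relation.ReflTransGen (FanStep H f c x) y v → v ≠ x := by
    intro v hv
    rcases Relation.ReflTransGen.cases_tail hv with rfl | ⟨u, -, h⟩
    · exact hxy.symm
    · exact h.1.ne'
  obtain ⟨π, hπ, hπf, hπc, hπx, hπm⟩ := exists_dart_pairing H c a b hab x
  -- At a fan vertex `b` occurs at most `f v` times and `a` at least that often, so a maximal
  -- pairing uses every `b`-dart.
  have hTπ : ∀ v, Relation.ReflTransGen (FanStep H f c x) y v →
      ∀ d, d.fst = v → c d.edge = b → π d ≠ d := by
    intro v hv d hdv hdb hd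
    rcases hπm v (hTx v hv) with h | h
    · have := cnt_exchange_le_of_paired (K := ∅) hab (by simp) (Or.inl rfl) (Or.inl rfl) π
        (fun d hd hda => ⟨(hπf d).trans hd, by rw [hπc d (h d hd hda), hda],
          by simp⟩) {d} (by
          simp only [mem_singleton, forall_eq, Equiv.swap_apply_left]
          refine ⟨hdv, hdb, ?_, ?_⟩
          · rw [exchange_edge_of_notMem (by simp) (by simp), hdb]
            exact Ne.symm hab
          · intro d' hd'v hd' h
            have : d' = d := π.injective (h.trans hd.symm)
            rw [this, hdb] at hd'
            exact hab hd'.symm)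
      have he : exchange H c a b ∅ = c := by
        funext e
        exact if_neg (by simp)
      rw [he, card_singleton, Equiv.swap_apply_left] at this
      have h1 := hTa v hv
      have h2 := hc v b
      omega
    · exact h d hdv hdb hd
  by_contra hlt
  push Not at hlt
  set S : Finset (twoColorGraph H c a b).Dart :=
    {d | Relation.ReflTransGen (FanStep H f c x) y d.fst ∧ c d.edge = a ∧ π d = d} with hS
  have hScard : f x < #S := by
    refine hlt.trans_le ?_
    rw [card_eq_sum_card_fiberwise (f := fun d => d.fst)
      (t := ({t | Relation.ReflTransGen (FanStep H f c x) y t} : Finset V))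
      (fun d hd => by simpa using (mem_filter.1 hd).2.1)]
    refine sum_le_sum fun t ht => ?_
    have ht := (mem_filter.1 ht).2
    have h1 := hTa t ht
    rw [cnt_eq_card_dart_self t (Or.inl rfl)] at h1
    rw [← card_filter_add_card_filter_not (fun d => π d = d)] at h1
    have h2 : #{d ∈ ({d | d.fst = t ∧ c d.edge = a} : Finset (twoColorGraph H c a b).Dart) |
        ¬ π d = d} ≤ cnt H c t b := by
      rw [cnt_eq_card_dart_self t (Or.inr rfl)]
      refine card_le_card_of_injOn π ?_ π.injective.injOn
      intro d hd
      obtain ⟨hd1, hd2⟩ := mem_filter.1 hd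
      have hd1 := (mem_filter.1 hd1).2
      have := hπc d hd2
      rw [hd1.2, Equiv.swap_apply_left] at this
      simp [hπf, hd1.1, this]
    have h3 : #{d ∈ ({d | d.fst = t ∧ c d.edge = a} : Finset (twoColorGraph H c a b).Dart) |
        π d = d} ≤ #{d ∈ S | d.fst = t} := by
      refine card_le_card fun d hd => ?_
      obtain ⟨hd1, hd2⟩ := mem_filter.1 hd
      have hd1 := (mem_filter.1 hd1).2
      simp [hS, hd1, hd2, ht]
    omega
  let ι : Equiv.Perm (twoColorGraph H c a b).Dart :=
    Function.Involutive.toPerm SimpleGraph.Dart.symm SimpleGraph.Dart.symm_involutive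
  have hmate := fun d hd => exists_mate ι π SimpleGraph.Dart.symm_involutive hπ
    (fun d => d.symm_ne) d hd
  have hclosed := fun d hd => (hmate d hd).1
  have hmate' : ∀ d, ∃ m, π d = d → m ≠ d ∧ (π * ι).SameCycle d m ∧ π m = m ∧
      ∀ d', (π * ι).SameCycle d d' → π d' = d' → d' = d ∨ d' = m := by
    intro d
    by_cases hd : π d = d
    · obtain ⟨m, hm⟩ := (hmate d hd).2
      exact ⟨m, fun _ => hm⟩
    · exact ⟨d, fun h => absurd h hd⟩
  choose m hm using hmate'
  have hm_inj : ∀ d d', π d = d → π d' = d' → m d = m d' → d = d' := by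
    intro d d' hd hd' h
    obtain ⟨h1, h2, h3, h4⟩ := hm d hd
    obtain ⟨h1', h2', -, -⟩ := hm d' hd'
    have : (π * ι).SameCycle d d' := h2.trans (h ▸ h2'.symm)
    rcases h4 d' this hd' with h5 | h5
    · exact h5.symm
    · exact absurd (h5.symm ▸ h).symm (h ▸ h ▸ h1')
  have hSmem : ∀ d ∈ S, Relation.ReflTransGen (FanStep H f c x) y d.fst ∧ c d.edge = a ∧ π d = d :=
    fun d hd => (mem_filter.1 hd).2
  have hKx : ∀ σ ∈ S, ∀ d, (π * ι).SameCycle σ d → d.fst = x → d = m σ := by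
    intro σ hσ d hd hdx
    obtain ⟨h1, -, h2⟩ := hSmem σ hσ
    refine ((hm σ h2).2.2.2 d hd (hπx d hdx)).resolve_left ?_
    rintro rfl
    exact hTx _ h1 hdx
  have finish := exists_good_of_exchange hxy hGH hab hc hx π hπ hπf hπc hπm hTa hTπ
  by_cases hA : ∃ σ ∈ S, (m σ).fst ≠ x
  · obtain ⟨σ, hσ, hmσ⟩ := hA
    obtain ⟨h1, -, h2⟩ := hSmem σ hσ
    have hno : ∀ d, (π * ι).SameCycle σ d → d.fst ≠ x := by
      -- All darts at `x` are unpaired, so a chain can meet `x` only at its far end.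
      intro d hd hdx
      exact hmσ (hKx σ hσ d hd hdx ▸ hdx)
    have hsymm : ∀ d ∈ {d | (π * ι).SameCycle σ d}, d.symm ∈ {d | (π * ι).SameCycle σ d} :=
      fun d hd => (hclosed σ h2 d hd).1
    refine hG (finish {d | (π * ι).SameCycle σ d} hsymm
      (fun d hd => (hclosed σ h2 d hd).2) ?_ σ (Equiv.Perm.SameCycle.refl _ _) h2 ?_)
    · intro q
      exact cnt_exchange_le_of_paired_mem hsymm q 1 fun d hd hdx => absurd hdx (hno d hd)
    · refine (fan_path_one_color b h1).imp_right ?_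
      rintro ⟨s, z, hs, hsz, hzb, hz⟩
      refine ⟨s, z, hs, hsz, hzb, hz, ?_⟩
      exact exchange_edge_of_notMem hsymm
        (d := ⟨(x, z), hsz.1, Or.inr hzb⟩) (fun h => hno _ h rfl)
  push Not at hA
  have hcount : ∀ r, (r = a ∨ r = b) → #{σ ∈ S | c (m σ).edge = r} ≤ cnt H c x r := by
    intro r hr
    rw [cnt_eq_card_dart_self x hr]
    refine card_le_card_of_injOn m ?_ ?_
    · intro σ hσ
      obtain ⟨h1, h2⟩ := mem_filter.1 hσ
      simp [hA σ h1, h2]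
    · intro σ hσ σ' hσ' h
      exact hm_inj _ _ (hSmem σ (mem_filter.1 hσ).1).2.2 (hSmem σ' (mem_filter.1 hσ').1).2.2 h
  have hsplit : #S ≤ #{σ ∈ S | c (m σ).edge = a} + #{σ ∈ S | c (m σ).edge = b} := by
    refine le_trans (card_le_card ?_) (card_union_le _ _)
    intro σ hσ
    rcases twoColorGraph_dart_color (m σ) with h | h
    · exact mem_union_left _ (mem_filter.2 ⟨hσ, h⟩)
    · exact mem_union_right _ (mem_filter.2 ⟨hσ, h⟩)
  have ha' := hcount a (Or.inl rfl)
  have hb' := (hcount b (Or.inr rfl)).trans (hc x b)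
  -- At most `f x` chains end in `b` and, since `a` is missing at `x`, at most `f x - 1` end in `a`.
  -- Having more than `f x` chains leaves at least one of the first color and two of the second.
  obtain ⟨σ₁, hσ₁⟩ : ({σ ∈ S | c (m σ).edge = a}).Nonempty := card_pos.1 (by omega)
  obtain ⟨σ, hσ, σ', hσ', hne⟩ := one_lt_card.1
    (show 1 < #{σ ∈ S | c (m σ).edge = b} by omega)
  -- The fan path to the start of `σ₁` may use one `b`-edge `xz`, which has to keep its color. This
  -- is why two chains ending in `b` are needed.
  have hchoose : ∀ z, ∃ σ₂ ∈ S, c (m σ₂).edge = b ∧ (m σ₂).snd ≠ z := by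
    intro z
    obtain ⟨h1, h2⟩ := mem_filter.1 hσ
    obtain ⟨h1', h2'⟩ := mem_filter.1 hσ'
    by_cases hz : (m σ).snd = z
    · refine ⟨σ', h1', h2', fun h => hne ?_⟩
      refine hm_inj _ _ (hSmem σ h1).2.2 (hSmem σ' h1').2.2 ?_
      exact SimpleGraph.Dart.ext _ _ (Prod.ext ((hA σ h1).trans (hA σ' h1').symm) (hz.trans h.symm))
    · exact ⟨σ, h1, h2, hz⟩
  obtain ⟨h1S, h1m⟩ := mem_filter.1 hσ₁
  obtain ⟨h11, -, h12⟩ := hSmem σ₁ h1S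
  have main : ∀ σ₂ ∈ S, c (m σ₂).edge = b →
      (Relation.ReflTransGen (fun u v => FanStep H f c x u v ∧ c s(x, v) ≠ b) y σ₁.fst ∨
      ∃ s z, Relation.ReflTransGen (fun u v => FanStep H f c x u v ∧ c s(x, v) ≠ b) y s ∧
        FanStep H f c x s z ∧ c s(x, z) = b ∧
        Relation.ReflTransGen (fun u v => FanStep H f c x u v ∧ c s(x, v) ≠ b) z σ₁.fst ∧
        (m σ₂).snd ≠ z) → False := by
    intro σ₂ h2S h2m hp
    obtain ⟨-, -, h22⟩ := hSmem σ₂ h2S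
    set K : Set (twoColorGraph H c a b).Dart :=
      {d | (π * ι).SameCycle σ₁ d ∨ (π * ι).SameCycle σ₂ d} with hK
    have hsymm : ∀ d ∈ K, d.symm ∈ K := fun d hd =>
      hd.imp (fun h => (hclosed σ₁ h12 d h).1) (fun h => (hclosed σ₂ h22 d h).1)
    have hKπ : ∀ d ∈ K, π d ∈ K := fun d hd =>
      hd.imp (fun h => (hclosed σ₁ h12 d h).2) (fun h => (hclosed σ₂ h22 d h).2)
    have hKx' : ∀ d ∈ K, d.fst = x → d = m σ₁ ∨ d = m σ₂ := fun d hd hdx =>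
      hd.imp (fun h => hKx σ₁ h1S d h hdx) (fun h => hKx σ₂ h2S d h hdx)
    refine hG (finish K hsymm hKπ ?_ σ₁ (Or.inl (Equiv.Perm.SameCycle.refl _ _)) h12
      (hp.imp_right ?_))
    · intro q
      refine cnt_exchange_le_of_paired_mem hsymm q (Equiv.swap (m σ₁) (m σ₂)) fun d hd hdx => ?_
      rcases hKx' d hd hdx with rfl | rfl
      · rw [Equiv.swap_apply_left, h1m, h2m, Equiv.swap_apply_left]
        exact ⟨hA _ h2S, rfl, Or.inr (hm σ₂ h22).2.1⟩
      · rw [Equiv.swap_apply_right, h1m, h2m, Equiv.swap_apply_right]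
        exact ⟨hA _ h1S, rfl, Or.inl (hm σ₁ h12).2.1⟩
    · rintro ⟨s, z, hs, hsz, hzb, hz, hne⟩
      refine ⟨s, z, hs, hsz, hzb, hz, ?_⟩
      refine exchange_edge_of_notMem hsymm (d := ⟨(x, z), hsz.1, Or.inr hzb⟩) fun h => ?_
      rcases hKx' _ h rfl with h | h
      · rw [← h] at h1m
        exact hab (h1m.symm.trans hzb)
      · exact hne (by rw [← h])
  rcases fan_path_one_color b h11 with hp | ⟨s, z, hs, hsz, hzb, hz⟩
  · obtain ⟨σ₂, h2S, h2m, -⟩ := hchoose x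
    exact main σ₂ h2S h2m (Or.inl hp)
  · obtain ⟨σ₂, h2S, h2m, hne⟩ := hchoose z
    exact main σ₂ h2S h2m (Or.inr ⟨s, z, hs, hsz, hzb, hz, hne⟩)

end SlotBound

/-! ### The adjacency lemma and the structure of uncolorable graphs. -/

section Critical

variable {V : Type*} [Fintype V] {f : V → ℕ} {k : ℕ}

/-- The adjacency lemma: if `G` has no `f`-coloring with `k` colors but `G - xy` has one, then `x`
has many neighbors `t` with `deg t = f t * k`. -/
theorem le_card_core_neighbors {G : SimpleGraph V} {x y : V} (hxy : G.Adj x y)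
    {c : Sym2 V → Fin k} (hc : Good (G.deleteEdges {s(x, y)}) f c)
    (hdeg : ∀ v, deg G v ≤ f v * k) (hG : ¬ ∃ c' : Sym2 V → Fin k, Good G f c') :
    2 + (f y * k - deg G y - 1) ≤ #{t | G.Adj x t ∧ deg G t = f t * k} := by
  set H := G.deleteEdges {s(x, y)} with hH
  have hle : H ≤ G := SimpleGraph.deleteEdges_le _
  have hGH : ∀ v w, G.Adj v w → s(v, w) ≠ s(x, y) → H.Adj v w := by
    intro v w h hne
    rw [hH, SimpleGraph.deleteEdges_adj]
    exact ⟨h, hne⟩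
  have hdx : deg H x < deg G x := deg_lt_deg hle hxy (by simp [hH])
  have hdy : deg H y < deg G y := deg_lt_deg hle hxy.symm (by simp [hH])
  obtain ⟨a, ha⟩ : ∃ a, cnt H c x a < f x := by
    by_contra! h
    have h1 : ∑ _a : Fin k, f x ≤ ∑ a, cnt H c x a := sum_le_sum fun a _ => h a
    rw [← deg_eq_sum_cnt, sum_const, card_univ, Fintype.card_fin, smul_eq_mul, mul_comm] at h1
    have := hdeg x
    omega
  set T : Finset V := {t | Relation.ReflTransGen (FanStep H f c x) y t} with hT
  have hyT : y ∈ T := by simp [hT, Relation.ReflTransGen.refl]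
  -- If some fan vertex misses `b`, then `x` does not, so `x` has `f x` edges of color `b`; all of
  -- them lead into the fan. The vertex `y` is left out because `xy` is uncolored.
  have hcolor : ∀ b, ∑ t ∈ T, (f t - cnt H c t b) ≤ #{z ∈ T.erase y | c s(x, z) = b} := by
    intro b
    rcases Nat.eq_zero_or_pos (∑ t ∈ T, (f t - cnt H c t b)) with h0 | hpos
    · rw [h0]; exact Nat.zero_le _
    obtain ⟨t, ht, htb⟩ := exists_ne_zero_of_sum_ne_zero hpos.ne'
    have htT := (mem_filter.1 ht).2
    have hxb : f x ≤ cnt H c x b := not_lt.1 fun h =>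
      hG (exists_good_of_fan hxy.ne hGH hc h htT (by omega))
    refine (sum_missing_le hxy.ne hGH hc ha hG b).trans (hxb.trans (cnt_le_card ?_))
    intro z hz1 hz2
    rw [mem_filter, mem_erase]
    refine ⟨⟨?_, mem_filter.2 ⟨mem_univ _, htT.tail ⟨hz1, ?_⟩⟩⟩, hz2⟩
    · rintro rfl
      simp [hH] at hz1
    · rw [hz2]; omega
  have hsum : ∑ t ∈ T, (f t * k - deg H t) + 1 ≤ #T := by
    have h1 : ∑ t ∈ T, (f t * k - deg H t) = ∑ t ∈ T, ∑ b, (f t - cnt H c t b) := by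
      refine sum_congr rfl fun t _ => ?_
      rw [deg_eq_sum_cnt H c t, sum_tsub_distrib _ (fun b _ => hc t b), sum_const, card_univ,
        Fintype.card_fin, smul_eq_mul, mul_comm]
    have h2 : ∑ b, #{z ∈ T.erase y | c s(x, z) = b} = #(T.erase y) :=
      (card_eq_sum_card_fiberwise (f := fun z => c s(x, z)) (t := univ) (by simp)).symm
    have h3 := sum_le_sum fun b (_ : b ∈ univ) => hcolor b
    rw [sum_comm, ← h1, h2, card_erase_of_mem hyT] at h3
    have := card_pos.2 ⟨y, hyT⟩
    omega
  -- Restoring `xy` lowers the deficiency at `y` by one, which turns the 1 into a 2.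
  have hsum2 : ∑ t ∈ T, (f t * k - deg G t) + 2 ≤ #T := by
    have : ∑ t ∈ T, (f t * k - deg G t) < ∑ t ∈ T, (f t * k - deg H t) := by
      refine sum_lt_sum (fun t _ => Nat.sub_le_sub_left (deg_mono hle t) _) ⟨y, hyT, ?_⟩
      have := hdeg y
      omega
    omega
  have hsplit : #T = #{t ∈ T | deg G t = f t * k} +
      ∑ t ∈ T, (if deg G t = f t * k then 0 else 1) := by
    rw [card_eq_sum_ones, card_filter, ← sum_add_distrib]
    refine sum_congr rfl fun t _ => ?_
    split_ifs <;> rfl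
  have hdef : ∀ t, (if deg G t = f t * k then 0 else 1) ≤ f t * k - deg G t := by
    intro t
    have := hdeg t
    split_ifs <;> omega
  have hrest : ∑ t ∈ T.erase y, (if deg G t = f t * k then 0 else 1) ≤
      ∑ t ∈ T.erase y, (f t * k - deg G t) := sum_le_sum fun t _ => hdef t
  rw [← add_sum_erase _ _ hyT] at hsum2
  rw [← add_sum_erase T (fun t => if deg G t = f t * k then 0 else 1) hyT] at hsplit
  have hsub : #{t ∈ T | deg G t = f t * k} ≤ #{t | G.Adj x t ∧ deg G t = f t * k} := by
    refine card_le_card fun t ht => ?_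
    obtain ⟨h1, h2⟩ := mem_filter.1 ht
    refine mem_filter.2 ⟨mem_univ _, ?_, h2⟩
    rcases Relation.ReflTransGen.cases_tail (mem_filter.1 h1).2 with rfl | ⟨u, -, h⟩
    · exact hxy
    · exact hle h.1
  have := hdeg y
  by_cases hy : deg G y = f y * k
  · simp only [hy, if_true] at hsplit hsum2 ⊢
    omega
  · simp only [hy, if_false] at hsplit
    omega

/-- If `G` has no `f`-coloring with `k` colors and every vertex of the core has at most
two neighbors in the core, then some union of components of `G` consists of vertices of degree at
least `f v * k - 1`. -/
theorem exists_closed_of_not_good {G : SimpleGraph V} (hk : 0 < k)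
    (hdeg : ∀ v, deg G v ≤ f v * k)
    (hcore : ∀ v, deg G v = f v * k → #{w | G.Adj v w ∧ deg G w = f w * k} ≤ 2)
    (hG : ¬ ∃ c : Sym2 V → Fin k, Good G f c) :
    ∃ S : Set V, S.Nonempty ∧ (∀ v ∈ S, ∀ w, G.Adj v w → w ∈ S) ∧
      ∀ v ∈ S, (∃ w, G.Adj v w) ∧ f v * k ≤ deg G v + 1 := by
  -- In a minimal uncolorable subgraph the adjacency lemma applies to every edge, in both
  -- directions.
  obtain ⟨H, hH⟩ := (Set.toFinite {H : SimpleGraph V | H ≤ G ∧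
    ¬ ∃ c : Sym2 V → Fin k, Good H f c}).exists_minimal ⟨G, le_rfl, hG⟩
  obtain ⟨hle, hHG⟩ := hH.prop
  have hdegH : ∀ v, deg H v ≤ f v * k := fun v => (deg_mono hle v).trans (hdeg v)
  have hcoreH : ∀ v, deg H v = f v * k → deg G v = f v * k := fun v h =>
    le_antisymm (hdeg v) (h ▸ deg_mono hle v)
  have hval : ∀ x y, H.Adj x y →
      2 + (f y * k - deg H y - 1) ≤ #{t | H.Adj x t ∧ deg H t = f t * k} := by
    intro x y hxy
    have hlt : ¬ H ≤ H.deleteEdges {s(x, y)} := fun h => by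
      simpa using h hxy
    obtain ⟨c, hc⟩ : ∃ c : Sym2 V → Fin k, Good (H.deleteEdges {s(x, y)}) f c := by
      by_contra h
      exact hlt (hH.le_of_le ⟨(SimpleGraph.deleteEdges_le _).trans hle, h⟩
        (SimpleGraph.deleteEdges_le _))
    exact le_card_core_neighbors hxy hc hdegH hHG
  have hmain : ∀ x y, H.Adj x y → f x * k ≤ deg H x + 1 ∧ ∀ w, G.Adj x w → H.Adj x w := by
    intro x y hxy
    obtain ⟨u, hu⟩ : ({t | H.Adj x t ∧ deg H t = f t * k} : Finset V).Nonempty :=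
      card_pos.1 (by have := hval x y hxy; omega)
    obtain ⟨hxu, huc⟩ := (mem_filter.1 hu).2
    -- Seen from the core vertex `u`, the bound 2 + (deficiency of `x` - 1) is at most 2, so `x` has
    -- deficiency at most 1 and `u` already has two core neighbors in `H`. If `x` lost an edge of
    -- `G`, it would be a core vertex of `G` but not of `H`, hence a third core neighbor of `u`.
    have h1 := hval u x hxu.symm
    have h2 := hcore u (hcoreH u huc)
    have hsub : ({t | H.Adj u t ∧ deg H t = f t * k} : Finset V) ⊆
        ({w | G.Adj u w ∧ deg G w = f w * k} : Finset V) :=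
      monotone_filter_right _ fun w _ hw => ⟨hle hw.1, hcoreH w hw.2⟩
    have h3 := card_le_card hsub
    have hdx := hdegH x
    refine ⟨by omega, ?_⟩
    by_contra! hw
    obtain ⟨w, hw, hw'⟩ := hw
    have hlt : deg H x < deg G x := deg_lt_deg hle hw hw'
    have hxG : deg G x = f x * k := by have := hdeg x; omega
    have := card_lt_card (ssubset_iff_of_subset hsub |>.2 ⟨x, by simp [hle hxu.symm, hxG],
      fun h => by have := (mem_filter.1 h).2.2; omega⟩)
    omega
  refine ⟨{v | ∃ w, H.Adj v w}, ?_, ?_, ?_⟩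
  · by_contra hS
    refine hHG ⟨fun _ => ⟨0, hk⟩, fun v q => ?_⟩
    have : cnt H (fun _ => ⟨0, hk⟩) v q ≤ #(∅ : Finset V) :=
      cnt_le_card fun w h _ => absurd ⟨v, w, h⟩ hS
    exact this.trans (Nat.zero_le _)
  · rintro v ⟨w, hw⟩ u hu
    exact ⟨v, ((hmain v w hw).2 u hu).symm⟩
  · rintro v ⟨w, hw⟩
    exact ⟨⟨w, hle hw⟩, (hmain v w hw).1.trans (Nat.add_le_add_right (deg_mono hle v) 1)⟩

end Critical

/-! ### Gluing the two sides of a cut; contracting one side. -/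

section Cut

variable {V : Type*} [Fintype V] {G : SimpleGraph V} {f : V → ℕ} {k : ℕ} {X : Set V}

/-- The edges between `X` and its complement. -/
noncomputable def cutEdges (G : SimpleGraph V) (X : Set V) : Finset (V × V) :=
  {p | p.1 ∈ X ∧ p.2 ∉ X ∧ G.Adj p.1 p.2}

theorem mem_cutEdges {p : V × V} : p ∈ cutEdges G X ↔ p.1 ∈ X ∧ p.2 ∉ X ∧ G.Adj p.1 p.2 := by
  simp [cutEdges]

theorem card_cutEdges_compl_le : #(cutEdges G Xᶜ) ≤ #(cutEdges G X) := by
  refine card_le_card_of_injOn Prod.swap (fun p hp => ?_) Prod.swap_injective.injOn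
  obtain ⟨h1, h2, h3⟩ := mem_cutEdges.1 hp
  exact mem_cutEdges.2 ⟨not_not.1 h2, h1, h3.symm⟩

/-- The edges with an end in `X` are colored so that the condition holds at the vertices of `X`, and
the edges leaving `X` have distinct colors. -/
def SideGood (G : SimpleGraph V) (f : V → ℕ) (X : Set V) (c : Sym2 V → Fin k) : Prop :=
  (∀ v ∈ X, ∀ a, cnt G c v a ≤ f v) ∧
    ∀ u ∈ X, ∀ w, w ∉ X → ∀ u' ∈ X, ∀ w', w' ∉ X → G.Adj u w → G.Adj u' w' →
      c s(u, w) = c s(u', w') → u = u' ∧ w = w'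

/-- Both colorings are injective on the cut edges, so the bijection between the two sets of cut
colors extends to a permutation of all colors that makes them agree on the cut. -/
theorem exists_good_of_sideGood {c₁ c₂ : Sym2 V → Fin k} (h₁ : SideGood G f X c₁)
    (h₂ : SideGood G f Xᶜ c₂) : ∃ c : Sym2 V → Fin k, Good G f c := by
  let E := {p : V × V // p.1 ∈ X ∧ p.2 ∉ X ∧ G.Adj p.1 p.2}
  let g₁ : E → Fin k := fun p => c₁ s(p.1.1, p.1.2)
  let g₂ : E → Fin k := fun p => c₂ s(p.1.1, p.1.2)
  have hg₁ : Function.Injective g₁ := by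
    rintro ⟨⟨u, w⟩, hu, hw, h⟩ ⟨⟨u', w'⟩, hu', hw', h'⟩ heq
    obtain ⟨rfl, rfl⟩ := h₁.2 u hu w hw u' hu' w' hw' h h' heq
    rfl
  have hg₂ : Function.Injective g₂ := by
    rintro ⟨⟨u, w⟩, hu, hw, h⟩ ⟨⟨u', w'⟩, hu', hw', h'⟩ heq
    have heq' : c₂ s(w, u) = c₂ s(w', u') := by
      rw [Sym2.eq_swap, Sym2.eq_swap (a := w')]; exact heq
    obtain ⟨rfl, rfl⟩ := h₂.2 w hw u (not_not.2 hu) w' hw' u' (not_not.2 hu') h.symm h'.symm heq'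
    rfl
  let e : {a // a ∈ Set.range g₂} ≃ {a // a ∈ Set.range g₁} :=
    (Equiv.ofInjective g₂ hg₂).symm.trans (Equiv.ofInjective g₁ hg₁)
  let ρ : Equiv.Perm (Fin k) := e.extendSubtype
  have hρ : ∀ u w, u ∈ X → w ∉ X → G.Adj u w → ρ (c₂ s(u, w)) = c₁ s(u, w) := by
    intro u w hu hw h
    have hmem : c₂ s(u, w) ∈ Set.range g₂ := ⟨⟨(u, w), hu, hw, h⟩, rfl⟩
    have h1 : ρ (c₂ s(u, w)) = e ⟨c₂ s(u, w), hmem⟩ := e.extendSubtype_apply_of_mem _ hmem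
    rw [h1]
    have h2 : (Equiv.ofInjective g₂ hg₂).symm ⟨c₂ s(u, w), hmem⟩ = ⟨(u, w), hu, hw, h⟩ := by
      rw [Equiv.symm_apply_eq]
      rfl
    change ((Equiv.ofInjective g₁ hg₁) ((Equiv.ofInjective g₂ hg₂).symm _) : Fin k) = _
    rw [h2]
    rfl
  refine ⟨fun e => if ∃ v ∈ e, v ∈ X then c₁ e else ρ (c₂ e), fun v a => ?_⟩
  by_cases hv : v ∈ X
  · refine le_trans (cnt_le_cnt_of_injOn id (fun w hw hq => ⟨hw, ?_⟩) (fun _ _ _ _ h => h))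
      (h₁.1 v hv a)
    rw [← hq]
    exact (if_pos ⟨v, Sym2.mem_mk_left _ _, hv⟩).symm
  · refine le_trans (cnt_le_cnt_of_injOn id (fun w hw hq => ⟨hw, ?_⟩) (fun _ _ _ _ h => h))
      (h₂.1 v hv (ρ.symm a))
    rw [Equiv.eq_symm_apply, ← hq, id]
    by_cases hwX : w ∈ X
    · rw [Sym2.eq_swap, hρ w v hwX hv hw.symm]
      exact (if_pos ⟨w, Sym2.mem_mk_left _ _, hwX⟩).symm
    · refine (if_neg ?_).symm
      rintro ⟨u, hu, huX⟩
      rcases Sym2.mem_iff.1 hu with rfl | rfl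
      · exact hv huX
      · exact hwX huX

/-- The graph obtained by moving all ends outside `X` to the vertex `z`. -/
def contractGraph (G : SimpleGraph V) (X : Set V) (z : V) : SimpleGraph V where
  Adj p q := p ≠ q ∧ ∃ u w, G.Adj u w ∧ (if u ∈ X then u else z) = p ∧ (if w ∈ X then w else z) = q
  symm := ⟨by rintro p q ⟨hne, u, w, h, hu, hw⟩; exact ⟨hne.symm, w, u, h.symm, hw, hu⟩⟩
  loopless := ⟨fun p h => h.1 rfl⟩

/-- If every vertex of `X` has at most one neighbor outside `X`, the side `X` can be colored. -/
theorem exists_sideGood_of_unique (hcl : ∀ S : Set V, S.Nonempty →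
      (∀ v ∈ S, ∀ w, G.Adj v w → w ∈ S) → S = Set.univ) (hf : ∀ v, 0 < f v)
    (hdeg : ∀ v, deg G v ≤ f v * k)
    (hcore : ∀ v, deg G v = f v * k → #{w | G.Adj v w ∧ deg G w = f w * k} ≤ 2)
    {z : V} (hz : z ∉ X) (hm : ∀ u ∈ X, ∀ w w', w ∉ X → w' ∉ X → G.Adj u w → G.Adj u w' → w = w')
    (hsize : #(cutEdges G X) + 2 ≤ k) : ∃ c : Sym2 V → Fin k, SideGood G f X c := by
  set φ : V → V := fun u => if u ∈ X then u else z with hφ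
  have hφ1 : ∀ u ∈ X, φ u = u := fun u hu => if_pos hu
  have hφ2 : ∀ u, u ∉ X → φ u = z := fun u hu => if_neg hu
  set G' := contractGraph G X z with hG'
  -- Capacity 1 at `z` forces distinct colors on the edges at `z`.
  set f' := Function.update f z 1 with hf'
  have hf'1 : ∀ v ∈ X, f' v = f v := fun v hv =>
    Function.update_of_ne (by rintro rfl; exact hz hv) _ _
  have hf'z : f' z = 1 := Function.update_self _ _ _
  have hadj : ∀ v ∈ X, ∀ w, G.Adj v w → G'.Adj v (φ w) := by
    intro v hv w h
    refine ⟨?_, v, w, h, hφ1 v hv, rfl⟩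
    by_cases hw : w ∈ X
    · rw [hφ1 w hw]; exact h.ne
    · rw [hφ2 w hw]; rintro rfl; exact hz hv
  have hadj' : ∀ v ∈ X, ∀ q, G'.Adj v q → ∃ w, G.Adj v w ∧ φ w = q := by
    rintro v hv q ⟨hne, u, w, h, hu, hw⟩
    change φ u = v at hu
    by_cases huX : u ∈ X
    · rw [hφ1 u huX] at hu
      exact ⟨w, hu ▸ h, hw⟩
    · rw [hφ2 u huX] at hu
      exact absurd (hu ▸ hv) hz
  have hverts : ∀ p q, G'.Adj p q → p ∈ X ∨ p = z := by
    rintro p q ⟨-, u, w, h, hu, -⟩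
    by_cases huX : u ∈ X
    · exact Or.inl (by rw [← hu, if_pos huX]; exact huX)
    · exact Or.inr (by rw [← hu, if_neg huX])
  have hdeg1 : ∀ v ∈ X, deg G' v ≤ deg G v := by
    intro v hv
    refine (deg_le_card (A := ({w | G.Adj v w} : Finset V).image φ) ?_).trans card_image_le
    intro q hq
    obtain ⟨w, hw, rfl⟩ := hadj' v hv q hq
    exact mem_image_of_mem _ (mem_filter.2 ⟨mem_univ _, hw⟩)
  have hdegz : deg G' z ≤ #(cutEdges G X) := by
    refine (deg_le_card (A := (cutEdges G X).image Prod.fst) ?_).trans card_image_le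
    intro q hq
    have hqX : q ∈ X := (hverts q z hq.symm).resolve_right hq.ne'
    obtain ⟨w, hw, hwz⟩ := hadj' q hqX z hq.symm
    have hwX : w ∉ X := fun h => hz (by rw [← hwz, hφ1 w h]; exact h)
    exact mem_image.2 ⟨(q, w), mem_cutEdges.2 ⟨hqX, hwX, hw⟩, rfl⟩
  have hdeg0 : ∀ v, v ∉ X → v ≠ z → deg G' v = 0 := by
    intro v hv hvz
    refine Nat.le_zero.1 (deg_le_card (A := ∅) fun q hq => ?_)
    exact absurd (hverts v q hq) (not_or.2 ⟨hv, hvz⟩)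
  have hcore' : ∀ v, deg G' v = f' v * k → v ∈ X ∧ deg G v = f v * k := by
    intro v hv
    by_cases hvX : v ∈ X
    · rw [hf'1 v hvX] at hv
      exact ⟨hvX, le_antisymm (hdeg v) (hv ▸ hdeg1 v hvX)⟩
    · exfalso
      by_cases hvz : v = z
      · subst hvz
        rw [hf'z] at hv
        omega
      · rw [hdeg0 v hvX hvz, hf', Function.update_of_ne hvz] at hv
        have := Nat.mul_pos (hf v) (show 0 < k by omega)
        omega
  obtain ⟨c', hc'⟩ : ∃ c : Sym2 V → Fin k, Good G' f' c := by
    by_contra hcon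
    obtain ⟨S, ⟨v, hv⟩, hS, hSdeg⟩ := exists_closed_of_not_good (by omega) (G := G') (f := f')
      (fun v => by
        by_cases hvX : v ∈ X
        · rw [hf'1 v hvX]; exact (hdeg1 v hvX).trans (hdeg v)
        by_cases hvz : v = z
        · rw [hvz, hf'z]; omega
        · rw [hdeg0 v hvX hvz]; exact Nat.zero_le _)
      (fun v hv => by
        obtain ⟨hvX, hv⟩ := hcore' v hv
        refine le_trans (card_le_card ?_) (hcore v hv)
        refine monotone_filter_right _ fun w _ hw => ?_
        obtain ⟨hwX, hwc⟩ := hcore' w hw.2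
        obtain ⟨w', h1, h2⟩ := hadj' v hvX w hw.1
        have : w' ∈ X := by
          by_contra h
          rw [hφ2 w' h] at h2
          exact hz (h2 ▸ hwX)
        rw [hφ1 w' this] at h2
        exact ⟨h2 ▸ h1, hwc⟩) hcon
    -- The vertex `z` has deficiency at least 2, so the obstruction avoids it. It then lies inside
    -- `X`, away from the cut, and is closed in `G` as well, contrary to connectedness.
    have hzS : z ∉ S := fun h => by
      have := (hSdeg z h).2
      rw [hf'z] at this
      omega
    have hSX : ∀ v ∈ S, v ∈ X := by
      intro v hv
      obtain ⟨w, hw⟩ := (hSdeg v hv).1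
      exact (hverts v w hw).resolve_right (fun h => hzS (h ▸ hv))
    refine hzS (hcl S ⟨v, hv⟩ (fun v hv w hw => ?_) ▸ Set.mem_univ z)
    have := hS v hv _ (hadj v (hSX v hv) w hw)
    by_cases hwX : w ∈ X
    · rwa [hφ1 w hwX] at this
    · rw [hφ2 w hwX] at this
      exact absurd this hzS
  refine ⟨fun e => c' (e.map φ), ?_, ?_⟩
  · intro v hv a
    rw [← hf'1 v hv]
    refine le_trans (cnt_le_cnt_of_injOn φ (fun w hw hq => ⟨hadj v hv w hw, ?_⟩) ?_) (hc' v a)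
    · rw [← hq, Sym2.map_mk, hφ1 v hv]
    · intro w w' h1 h2 h
      by_cases hwX : w ∈ X <;> by_cases hwX' : w' ∈ X
      · rwa [hφ1 w hwX, hφ1 w' hwX'] at h
      · rw [hφ1 w hwX, hφ2 w' hwX'] at h
        exact absurd (h ▸ hwX) hz
      · rw [hφ2 w hwX, hφ1 w' hwX'] at h
        exact absurd (h ▸ hwX') hz
      · exact hm v hv w w' hwX hwX' h1 h2
  · intro u hu w hw u' hu' w' hw' h h' heq
    simp only [Sym2.map_mk] at heq
    rw [hφ1 u hu, hφ1 u' hu', hφ2 w hw, hφ2 w' hw'] at heq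
    have hle := hc' z (c' s(u, z))
    rw [hf'z] at hle
    have h1 := hadj u hu w h
    have h2 := hadj u' hu' w' h'
    rw [hφ2 w hw] at h1
    rw [hφ2 w' hw'] at h2
    have : u = u' := eq_of_cnt_le_one hle h1.symm (by rw [Sym2.eq_swap]) h2.symm
      (by rw [Sym2.eq_swap, heq])
    subst this
    exact ⟨rfl, hm u hu w w' hw hw' h h'⟩

theorem exists_good_of_matching_cut (hcl : ∀ S : Set V, S.Nonempty →
      (∀ v ∈ S, ∀ w, G.Adj v w → w ∈ S) → S = Set.univ) (hf : ∀ v, 0 < f v)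
    (hdeg : ∀ v, deg G v ≤ f v * k)
    (hcore : ∀ v, deg G v = f v * k → #{w | G.Adj v w ∧ deg G w = f w * k} ≤ 2)
    {x z : V} (hx : x ∈ X) (hz : z ∉ X)
    (hm : ∀ u ∈ X, ∀ w w', w ∉ X → w' ∉ X → G.Adj u w → G.Adj u w' → w = w')
    (hm' : ∀ u, u ∉ X → ∀ w ∈ X, ∀ w' ∈ X, G.Adj u w → G.Adj u w' → w = w')
    (hsize : #(cutEdges G X) + 2 ≤ k) : ∃ c : Sym2 V → Fin k, Good G f c := by
  obtain ⟨c₁, h₁⟩ := exists_sideGood_of_unique hcl hf hdeg hcore hz hm hsize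
  obtain ⟨c₂, h₂⟩ := exists_sideGood_of_unique (X := Xᶜ) hcl hf hdeg hcore (not_not.2 hx)
    (fun u hu w w' hw hw' => hm' u hu w (not_not.1 hw) w' (not_not.1 hw'))
    ((Nat.add_le_add_right card_cutEdges_compl_le 2).trans hsize)
  exact exists_good_of_sideGood h₁ h₂

end Cut

/-! ### Splitting the center of a star cut. -/

section Star

variable {V : Type*} [Fintype V] {G : SimpleGraph V} {f : V → ℕ} {k : ℕ} {X : Set V}

/-- The graph on `X ∪ {z}` obtained from `G[X]` by moving the ends at `u` of the edges
between `u` and `A` to `z`. -/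
def splitGraph (G : SimpleGraph V) (X : Set V) (u z : V) (A B : Finset V) : SimpleGraph V where
  Adj p q := p ≠ q ∧ ((p ∈ X ∧ q ∈ X ∧ p ≠ u ∧ q ≠ u ∧ G.Adj p q) ∨ (p = u ∧ q ∈ B) ∨
    (q = u ∧ p ∈ B) ∨ (p = z ∧ q ∈ A) ∨ (q = z ∧ p ∈ A))
  symm := ⟨by
    rintro p q ⟨hne, h⟩
    refine ⟨hne.symm, ?_⟩
    have := G.adj_comm p q
    tauto⟩
  loopless := ⟨fun p h => h.1 rfl⟩

theorem splitGraph_spec {u z : V} (hu : u ∈ X) (hz : z ∉ X)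
    (hstar : ∀ p ∈ X, ∀ q, q ∉ X → G.Adj p q → p = u) {A B : Finset V}
    (hmem : ∀ w, w ∈ A ∨ w ∈ B ↔ w ∈ X ∧ G.Adj u w) :
    (∀ w ∈ B, (splitGraph G X u z A B).Adj u w) ∧ (∀ w ∈ A, (splitGraph G X u z A B).Adj z w) ∧
    (∀ v ∈ X, v ≠ u → ∀ w, w ≠ u → G.Adj v w → w ∈ X ∧ (splitGraph G X u z A B).Adj v w) ∧
    (∀ w, (splitGraph G X u z A B).Adj u w → w ∈ B) ∧
    (∀ w, (splitGraph G X u z A B).Adj z w → w ∈ A) ∧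
    (∀ v w, v ≠ u → v ≠ z → (splitGraph G X u z A B).Adj v w → v ∈ X ∧
      ((w ≠ u ∧ w ∈ X ∧ G.Adj v w) ∨ (w = u ∧ v ∈ B) ∨ (w = z ∧ v ∈ A))) := by
  have hzu : z ≠ u := by rintro rfl; exact hz hu
  have hAX : ∀ w ∈ A, w ∈ X ∧ G.Adj u w := fun w hw => (hmem w).1 (Or.inl hw)
  have hBX : ∀ w ∈ B, w ∈ X ∧ G.Adj u w := fun w hw => (hmem w).1 (Or.inr hw)
  have hXz : ∀ v ∈ X, v ≠ z := by rintro v hv rfl; exact hz hv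
  have adjB : ∀ w ∈ B, (splitGraph G X u z A B).Adj u w := fun w hw => ⟨(hBX w hw).2.ne, Or.inr (Or.inl ⟨rfl, hw⟩)⟩
  have adjA : ∀ w ∈ A, (splitGraph G X u z A B).Adj z w := fun w hw =>
    ⟨(hXz w (hAX w hw).1).symm, Or.inr (Or.inr (Or.inr (Or.inl ⟨rfl, hw⟩)))⟩
  have adjX : ∀ v ∈ X, v ≠ u → ∀ w, w ≠ u → G.Adj v w → w ∈ X ∧ (splitGraph G X u z A B).Adj v w := by
    intro v hv hvu w hwu h
    have hwX : w ∈ X := by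
      by_contra hw
      exact hvu (hstar v hv w hw h)
    exact ⟨hwX, h.ne, Or.inl ⟨hv, hwX, hvu, hwu, h⟩⟩
  have nbr_u : ∀ w, (splitGraph G X u z A B).Adj u w → w ∈ B := by
    rintro w ⟨hne, h⟩
    rcases h with h | h | h | h | h
    · exact absurd rfl h.2.2.1
    · exact h.2
    · exact absurd h.1.symm hne
    · exact absurd h.1.symm hzu
    · exact absurd (hAX u h.2).2 G.irrefl
  have nbr_z : ∀ w, (splitGraph G X u z A B).Adj z w → w ∈ A := by
    rintro w ⟨hne, h⟩
    rcases h with h | h | h | h | h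
    · exact absurd h.1 hz
    · exact absurd h.1 hzu
    · exact absurd (hBX z h.2).1 hz
    · exact h.2
    · exact absurd h.1.symm hne
  have nbr_X : ∀ v w, v ≠ u → v ≠ z → (splitGraph G X u z A B).Adj v w → v ∈ X ∧
      ((w ≠ u ∧ w ∈ X ∧ G.Adj v w) ∨ (w = u ∧ v ∈ B) ∨ (w = z ∧ v ∈ A)) := by
    rintro v w hvu hvz ⟨hne, h⟩
    rcases h with h | h | h | h | h
    · exact ⟨h.1, Or.inl ⟨h.2.2.2.1, h.2.1, h.2.2.2.2⟩⟩
    · exact absurd h.1 hvu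
    · exact ⟨(hBX v h.2).1, Or.inr (Or.inl h)⟩
    · exact absurd h.1 hvz
    · exact ⟨(hAX v h.2).1, Or.inr (Or.inr h)⟩
  exact ⟨adjB, adjA, adjX, nbr_u, nbr_z, nbr_X⟩

/-- If all edges leaving `X` have the common end `u ∈ X`, and the neighbors of `u` in `X` are
suitably divided into `A` and `B`, the split graph can be colored. -/
theorem exists_good_splitGraph (hcl : ∀ S : Set V, S.Nonempty →
      (∀ v ∈ S, ∀ w, G.Adj v w → w ∈ S) → S = Set.univ)
    (hdeg : ∀ v, deg G v ≤ f v * k)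
    (hcore : ∀ v, deg G v = f v * k → #{w | G.Adj v w ∧ deg G w = f w * k} ≤ 2)
    {u z : V} (hu : u ∈ X) (hz : z ∉ X) (hstar : ∀ p ∈ X, ∀ q, q ∉ X → G.Adj p q → p = u)
    {A B : Finset V} (hAB : Disjoint A B) (hmem : ∀ w, w ∈ A ∨ w ∈ B ↔ w ∈ X ∧ G.Adj u w)
    (hA : #A + 2 ≤ k) (hB : #B ≤ (f u - 1) * k)
    (hB' : #B = (f u - 1) * k → B.Nonempty → deg G u = f u * k)
    (hconn : B.Nonempty → ∃ b' ∈ B, ∃ b ∈ A,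
      Relation.ReflTransGen (fun v w => G.Adj v w ∧ w ≠ u) b' b) :
    ∃ c : Sym2 V → Fin k, Good (splitGraph G X u z A B)
      (Function.update (Function.update f u (f u - 1)) z 1) c := by
  have hzu : z ≠ u := by rintro rfl; exact hz hu
  have hAX : ∀ w ∈ A, w ∈ X ∧ G.Adj u w := fun w hw => (hmem w).1 (Or.inl hw)
  have hBX : ∀ w ∈ B, w ∈ X ∧ G.Adj u w := fun w hw => (hmem w).1 (Or.inr hw)
  have hABd : ∀ w ∈ A, w ∉ B := fun w h => disjoint_left.1 hAB h
  set G' := splitGraph G X u z A B with hG'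
  set f' := Function.update (Function.update f u (f u - 1)) z 1 with hf'
  have hf'z : f' z = 1 := Function.update_self _ _ _
  have hf'u : f' u = f u - 1 := by
    rw [hf', Function.update_of_ne hzu.symm, Function.update_self]
  have hf'1 : ∀ v, v ≠ u → v ≠ z → f' v = f v := by
    intro v h1 h2
    rw [hf', Function.update_of_ne h2, Function.update_of_ne h1]
  have hXz : ∀ v ∈ X, v ≠ z := by rintro v hv rfl; exact hz hv
  obtain ⟨adjB, adjA, adjX, nbr_u, nbr_z, nbr_X⟩ := splitGraph_spec hu hz hstar hmem
  rw [← hG'] at adjB adjA adjX nbr_u nbr_z nbr_X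
  have hdegX : ∀ v, v ≠ u → v ≠ z → deg G' v ≤ deg G v := by
    intro v hvu hvz
    refine (deg_le_card (A := ({w | G.Adj v w} : Finset V).image
      fun w => if w = u ∧ v ∈ A then z else w) ?_).trans card_image_le
    intro q hq
    obtain ⟨hvX, h | h | h⟩ := nbr_X v q hvu hvz hq
    · exact mem_image.2 ⟨q, mem_filter.2 ⟨mem_univ _, h.2.2⟩, if_neg fun h' => h.1 h'.1⟩
    · refine mem_image.2 ⟨u, mem_filter.2 ⟨mem_univ _, (hBX v h.2).2.symm⟩, ?_⟩
      rw [if_neg (fun h' => hABd v h'.2 h.2), h.1]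
    · refine mem_image.2 ⟨u, mem_filter.2 ⟨mem_univ _, (hAX v h.2).2.symm⟩, ?_⟩
      rw [if_pos ⟨rfl, h.2⟩, h.1]
  have hdegu : deg G' u ≤ #B := deg_le_card nbr_u
  have hdegz : deg G' z ≤ #A := deg_le_card nbr_z
  have hcore' : ∀ v w, G'.Adj v w → deg G' v = f' v * k → v ∈ X ∧ deg G v = f v * k := by
    intro v w hvw hv
    by_cases hvz : v = z
    · subst hvz
      rw [hf'z] at hv
      omega
    by_cases hvu : v = u
    · subst hvu
      rw [hf'u] at hv
      exact ⟨hu, hB' (by omega) ⟨w, nbr_u w hvw⟩⟩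
    · rw [hf'1 v hvu hvz] at hv
      exact ⟨(nbr_X v w hvu hvz hvw).1, le_antisymm (hdeg v) (hv ▸ hdegX v hvu hvz)⟩
  by_contra hcon
  obtain ⟨S, ⟨v₀, hv₀⟩, hS, hSdeg⟩ := exists_closed_of_not_good (by omega) (G := G') (f := f')
    (fun v => by
      by_cases hvz : v = z
      · rw [hvz, hf'z]; omega
      by_cases hvu : v = u
      · rw [hvu, hf'u]; omega
      · rw [hf'1 v hvu hvz]; exact (hdegX v hvu hvz).trans (hdeg v))
    (fun v hv => by
      -- An isolated vertex can satisfy the core equation trivially, for instance `u` when its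
      -- reduced capacity is 0, so it is treated apart.
      by_cases hiso : ∃ w, G'.Adj v w
      swap
      · rw [card_eq_zero.2]
        · exact Nat.zero_le _
        · exact filter_eq_empty_iff.2 fun w _ hw => hiso ⟨w, hw.1⟩
      obtain ⟨w₀, hw₀⟩ := hiso
      obtain ⟨hvX, hv⟩ := hcore' v w₀ hw₀ hv
      refine le_trans (card_le_card ?_) (hcore v hv)
      refine monotone_filter_right _ fun w _ hw => ?_
      obtain ⟨hwX, hwc⟩ := hcore' w v hw.1.symm hw.2
      refine ⟨?_, hwc⟩
      by_cases hvu : v = u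
      · subst hvu
        exact (hBX w (nbr_u w hw.1)).2
      · obtain ⟨-, h | h | h⟩ := nbr_X v w hvu (hXz v hvX) hw.1
        · exact h.2.2
        · rw [h.1]; exact (hBX v h.2).2.symm
        · exact absurd h.1 (hXz w hwX)) hcon
  have hzS : z ∉ S := fun h => by
    have := (hSdeg z h).2
    rw [hf'z] at this
    omega
  have hSX : ∀ v ∈ S, v ∈ X := by
    intro v hv
    by_cases hvu : v = u
    · rw [hvu]; exact hu
    obtain ⟨w, hw⟩ := (hSdeg v hv).1
    exact (nbr_X v w hvu (fun h => hzS (h ▸ hv)) hw).1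
  have hSA : ∀ v ∈ S, v ∉ A := fun v hv hvA => hzS (hS v hv z (adjA v hvA).symm)
  -- Were `u` in the obstruction, the path avoiding `u` from `B` to `A` would drag a vertex of `A`,
  -- and with it `z`, into it.
  have huS : u ∉ S := by
    intro huS
    obtain ⟨w, hw⟩ := (hSdeg u huS).1
    obtain ⟨b', hb', b, hb, hpath⟩ := hconn ⟨w, nbr_u w hw⟩
    suffices b ∈ S ∧ b ≠ u from hSA b this.1 hb
    clear hb
    induction hpath with
    | refl => exact ⟨hS u huS _ (adjB b' hb'), (hBX b' hb').2.ne'⟩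
    | tail _ h ih => exact ⟨hS _ ih.1 _ (adjX _ (hSX _ ih.1) ih.2 _ h.2 h.1).2, h.2⟩
  refine hzS (hcl S ⟨v₀, hv₀⟩ (fun v hv w hw => ?_) ▸ Set.mem_univ z)
  have hvu : v ≠ u := fun h => huS (h ▸ hv)
  by_cases hwu : w = u
  · subst hwu
    rcases (hmem v).2 ⟨hSX v hv, hw.symm⟩ with h | h
    · exact absurd h (hSA v hv)
    · exact hS v hv _ (adjB v h).symm
  · exact hS v hv w (adjX v (hSX v hv) hvu w hwu hw).2

/-- A coloring of the split graph gives a coloring of the side `X`. -/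
theorem exists_sideGood_of_good_splitGraph (hf : ∀ v, 0 < f v)
    {u z : V} (hu : u ∈ X) (hz : z ∉ X) (hstar : ∀ p ∈ X, ∀ q, q ∉ X → G.Adj p q → p = u)
    {A B : Finset V} (hAB : Disjoint A B) (hmem : ∀ w, w ∈ A ∨ w ∈ B ↔ w ∈ X ∧ G.Adj u w)
    (hA : #A + #(cutEdges G X) ≤ k) {c' : Sym2 V → Fin k}
    (hc' : Good (splitGraph G X u z A B)
      (Function.update (Function.update f u (f u - 1)) z 1) c') :
    ∃ c : Sym2 V → Fin k, SideGood G f X c := by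
  have hzu : z ≠ u := by rintro rfl; exact hz hu
  have hAX : ∀ w ∈ A, w ∈ X ∧ G.Adj u w := fun w hw => (hmem w).1 (Or.inl hw)
  have hBX : ∀ w ∈ B, w ∈ X ∧ G.Adj u w := fun w hw => (hmem w).1 (Or.inr hw)
  have hABd : ∀ w ∈ A, w ∉ B := fun w h => disjoint_left.1 hAB h
  set G' := splitGraph G X u z A B with hG'
  set f' := Function.update (Function.update f u (f u - 1)) z 1 with hf'
  have hf'z : f' z = 1 := Function.update_self _ _ _
  have hf'u : f' u = f u - 1 := by
    rw [hf', Function.update_of_ne hzu.symm, Function.update_self]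
  have hf'1 : ∀ v, v ≠ u → v ≠ z → f' v = f v := by
    intro v h1 h2
    rw [hf', Function.update_of_ne h2, Function.update_of_ne h1]
  have hXz : ∀ v ∈ X, v ≠ z := by rintro v hv rfl; exact hz hv
  obtain ⟨adjB, adjA, adjX, -, -, -⟩ := splitGraph_spec hu hz hstar hmem
  rw [← hG'] at adjB adjA adjX
  set W : Finset V := {w | w ∉ X ∧ G.Adj u w} with hW
  have hWmem : ∀ w, w ∈ W ↔ w ∉ X ∧ G.Adj u w := fun w => by simp [hW]
  -- The colors not used at `z` suffice to give the cut edges distinct colors. When `z` is merged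
  -- back into `u`, the `A`-edges and the cut edges together use each color at most once, and the
  -- `B`-edges at most `f u - 1` times.
  set M : Finset (Fin k) := univ \ A.image (fun w => c' s(z, w)) with hM
  have hcard : Fintype.card W ≤ Fintype.card M := by
    rw [Fintype.card_coe, Fintype.card_coe]
    have h1 : #W ≤ #(cutEdges G X) := by
      refine card_le_card_of_injOn (fun w => (u, w)) ?_ ?_
      · intro w hw
        have := (hWmem w).1 hw
        exact mem_cutEdges.2 ⟨hu, this.1, this.2⟩
      · intro w _ w' _ h
        exact (Prod.ext_iff.1 h).2
    have h2 : k - #(A.image (fun w => c' s(z, w))) ≤ #M := by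
      have := le_card_sdiff (A.image (fun w => c' s(z, w))) univ
      rwa [card_univ, Fintype.card_fin] at this
    have h3 : #(A.image (fun w => c' s(z, w))) ≤ #A := card_image_le
    omega
  obtain ⟨ψ⟩ := Function.Embedding.nonempty_of_card_le hcard
  let g : V → Fin k := fun w => if h : w ∈ W then (ψ ⟨w, h⟩ : Fin k) else
    if w ∈ A then c' s(z, w) else c' s(u, w)
  have hgW : ∀ w (h : w ∈ W), g w = ψ ⟨w, h⟩ := fun w h => dif_pos h
  have hXW : ∀ w ∈ X, w ∉ W := fun w h h' => ((hWmem w).1 h').1 h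
  have hgA : ∀ w ∈ A, g w = c' s(z, w) := fun w h =>
    (dif_neg (hXW w (hAX w h).1)).trans (if_pos h)
  have hgB : ∀ w ∈ B, g w = c' s(u, w) := fun w h =>
    (dif_neg (hXW w (hBX w h).1)).trans (if_neg fun h' => hABd w h' h)
  have hgWinj : ∀ w ∈ W, ∀ w' ∈ W, g w = g w' → w = w' := by
    intro w h w' h' heq
    rw [hgW w h, hgW w' h'] at heq
    exact congrArg Subtype.val (ψ.injective (Subtype.ext heq))
  have hgWA : ∀ w ∈ W, ∀ w' ∈ A, g w ≠ g w' := by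
    intro w h w' h' heq
    rw [hgW w h, hgA w' h'] at heq
    have := (ψ ⟨w, h⟩).2
    rw [heq] at this
    exact (mem_sdiff.1 this).2 (mem_image_of_mem _ h')
  have hgAinj : ∀ w ∈ A, ∀ w' ∈ A, g w = g w' → w = w' := by
    intro w h w' h' heq
    rw [hgA w h, hgA w' h'] at heq
    exact eq_of_cnt_le_one (hf'z ▸ hc' z (c' s(z, w))) (adjA w h) rfl (adjA w' h') heq.symm
  set c : Sym2 V → Fin k := fun e => if h : u ∈ e then g (Sym2.Mem.other h) else c' e with hc
  have hcu : ∀ w, c s(u, w) = g w := by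
    intro w
    have h : u ∈ s(u, w) := Sym2.mem_mk_left _ _
    have h1 : c s(u, w) = g (Sym2.Mem.other h) := dif_pos h
    rw [h1, Sym2.congr_right.1 (Sym2.other_spec h)]
  have hcne : ∀ v w, v ≠ u → w ≠ u → c s(v, w) = c' s(v, w) := by
    intro v w hv hw
    refine dif_neg fun h => ?_
    rcases Sym2.mem_iff.1 h with h | h
    · exact hv h.symm
    · exact hw h.symm
  refine ⟨c, ?_, ?_⟩
  · intro v hv a
    by_cases hvu : v = u
    · subst hvu
      have h1 : #{w | w ∈ A ∪ W ∧ g w = a} ≤ 1 := by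
        rw [card_le_one]
        intro w hw w' hw'
        obtain ⟨h1, h2⟩ := (mem_filter.1 hw).2
        obtain ⟨h1', h2'⟩ := (mem_filter.1 hw').2
        have heq := h2.trans h2'.symm
        rcases mem_union.1 h1 with h | h <;> rcases mem_union.1 h1' with h' | h'
        · exact hgAinj w h w' h' heq
        · exact absurd heq.symm (hgWA w' h' w h)
        · exact absurd heq (hgWA w h w' h')
        · exact hgWinj w h w' h' heq
      have h2 : #{w | w ∈ B ∧ g w = a} ≤ f v - 1 := by
        rw [← hf'u]
        refine le_trans (card_le_card ?_) (hc' v a)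
        intro w hw
        obtain ⟨h1, h2⟩ := (mem_filter.1 hw).2
        simp only [mem_filter, mem_univ, true_and]
        exact ⟨adjB w h1, by rw [← h2, hgB w h1]⟩
      have h3 : cnt G c v a ≤
          #(({w | w ∈ A ∪ W ∧ g w = a} : Finset V) ∪
            ({w | w ∈ B ∧ g w = a} : Finset V)) := by
        refine cnt_le_card fun w hw hwa => ?_
        rw [hcu] at hwa
        simp only [mem_union, mem_filter, mem_univ, true_and, hwa, and_true, hWmem]
        have := hmem w
        tauto
      have h4 := card_union_le ({w | w ∈ A ∪ W ∧ g w = a} : Finset V)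
        ({w | w ∈ B ∧ g w = a} : Finset V)
      have := hf v
      omega
    · rw [← hf'1 v hvu (hXz v hv)]
      refine le_trans (cnt_le_cnt_of_injOn (fun w => if w = u ∧ v ∈ A then z else w)
        (fun w hw hq => ?_) (fun w w' hw hw' h => ?_)) (hc' v a)
      · by_cases hwu : w = u
        · subst hwu
          rw [Sym2.eq_swap, hcu] at hq
          rcases (hmem v).2 ⟨hv, hw.symm⟩ with h | h
          · rw [if_pos ⟨rfl, h⟩]
            exact ⟨(adjA v h).symm, by rw [← hq, hgA v h, Sym2.eq_swap]⟩
          · rw [if_neg fun h' => hABd v h'.2 h]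
            exact ⟨(adjB v h).symm, by rw [← hq, hgB v h, Sym2.eq_swap]⟩
        · rw [if_neg fun h' => hwu h'.1]
          exact ⟨(adjX v hv hvu w hwu hw).2, by rw [← hcne v w hvu hwu, hq]⟩
      · have key : ∀ w, w ≠ u → G.Adj v w → w ≠ z := fun w hwu hw =>
          hXz w (adjX v hv hvu w hwu hw).1
        by_cases h1 : w = u ∧ v ∈ A <;> by_cases h2 : w' = u ∧ v ∈ A
        · exact h1.1.trans h2.1.symm
        · rw [if_pos h1, if_neg h2] at h
          exact absurd h.symm (key w' (fun h' => h2 ⟨h', h1.2⟩) hw')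
        · rw [if_neg h1, if_pos h2] at h
          exact absurd h (key w (fun h' => h1 ⟨h', h2.2⟩) hw)
        · rwa [if_neg h1, if_neg h2] at h
  · intro p hp w hw p' hp' w' hw' h h' heq
    obtain rfl := hstar p hp w hw h
    obtain rfl := hstar p' hp' w' hw' h'
    rw [hcu, hcu] at heq
    exact ⟨rfl, hgWinj w ((hWmem w).2 ⟨hw, h⟩) w' ((hWmem w').2 ⟨hw', h'⟩) heq⟩

end Star

/-! ### Bridges, star cuts, and translation to the stated definitions. -/

section Main

variable {V : Type*} [Fintype V] {G : SimpleGraph V} {f : V → ℕ} {k : ℕ} {X : Set V}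

/-- If `b` is the only neighbor of `u` in its component of `G - u`, so that `ub` is a bridge,
then `G` can be colored. -/
theorem exists_good_of_bridge (hcl : ∀ S : Set V, S.Nonempty →
      (∀ v ∈ S, ∀ w, G.Adj v w → w ∈ S) → S = Set.univ) (hf : ∀ v, 0 < f v)
    (hdeg : ∀ v, deg G v ≤ f v * k)
    (hcore : ∀ v, deg G v = f v * k → #{w | G.Adj v w ∧ deg G w = f w * k} ≤ 2)
    {u b : V} (hub : G.Adj u b) (hk : 3 ≤ k)
    (hC : ∀ v, Relation.ReflTransGen (fun v w => G.Adj v w ∧ w ≠ u) b v → G.Adj u v → v = b) :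
    ∃ c : Sym2 V → Fin k, Good G f c := by
  set C : Set V := {v | Relation.ReflTransGen (fun v w => G.Adj v w ∧ w ≠ u) b v} with hCdef
  have huC : u ∉ C := by
    intro h
    rcases Relation.ReflTransGen.cases_tail h with h | ⟨_, -, h⟩
    · exact hub.ne h
    · exact h.2 rfl
  have hcut : ∀ p ∈ C, ∀ q, q ∉ C → G.Adj p q → p = b ∧ q = u := by
    intro p hp q hq h
    have hqu : q = u := by
      by_contra hne
      exact hq (Relation.ReflTransGen.tail hp ⟨h, hne⟩)
    subst hqu
    exact ⟨hC p hp h.symm, rfl⟩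
  refine exists_good_of_matching_cut (X := C) hcl hf hdeg hcore (x := b) .refl huC ?_ ?_ ?_
  · intro p hp w w' hw hw' h h'
    exact (hcut p hp w hw h).2.trans (hcut p hp w' hw' h').2.symm
  · intro p hp w hw w' hw' h h'
    exact (hcut w hw p hp h.symm).1.trans (hcut w' hw' p hp h'.symm).1.symm
  · have : #(cutEdges G C) ≤ 1 := by
      rw [card_le_one]
      intro p hp p' hp'
      obtain ⟨h1, h2, h3⟩ := mem_cutEdges.1 hp
      obtain ⟨h1', h2', h3'⟩ := mem_cutEdges.1 hp'
      obtain ⟨e1, e2⟩ := hcut _ h1 _ h2 h3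
      obtain ⟨e1', e2'⟩ := hcut _ h1' _ h2' h3'
      exact Prod.ext (e1.trans e1'.symm) (e2.trans e2'.symm)
    omega

/-- Every vertex outside `X` has at most `u` as a neighbor in `X`, so that side is settled by
contraction. For `X` itself, `u` is split. If `G` were uncolorable, rigidity and connectedness would
give every vertex deficiency at most 1, which makes the degree of `u` large enough to choose the
parts `A` and `B`. -/
theorem exists_good_of_star_cut (hcl : ∀ S : Set V, S.Nonempty →
      (∀ v ∈ S, ∀ w, G.Adj v w → w ∈ S) → S = Set.univ) (hf : ∀ v, 0 < f v)
    (hdeg : ∀ v, deg G v ≤ f v * k)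
    (hcore : ∀ v, deg G v = f v * k → #{w | G.Adj v w ∧ deg G w = f w * k} ≤ 2)
    {u z : V} (hu : u ∈ X) (hz : z ∉ X) (hstar : ∀ p ∈ X, ∀ q, q ∉ X → G.Adj p q → p = u)
    (hsize : #(cutEdges G X) + 2 ≤ k) : ∃ c : Sym2 V → Fin k, Good G f c := by
  by_contra hG
  obtain ⟨c₂, h₂⟩ : ∃ c : Sym2 V → Fin k, SideGood G f Xᶜ c :=
    exists_sideGood_of_unique (X := Xᶜ) hcl hf hdeg hcore (not_not.2 hu)
      (fun v hv w w' hw hw' h h' => (hstar w (not_not.1 hw) v hv h.symm).trans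
        (hstar w' (not_not.1 hw') v hv h'.symm).symm)
      ((Nat.add_le_add_right card_cutEdges_compl_le 2).trans hsize)
  suffices ∃ c : Sym2 V → Fin k, SideGood G f X c by
    obtain ⟨c₁, h₁⟩ := this
    exact hG (exists_good_of_sideGood h₁ h₂)
  rcases Nat.lt_or_ge (#(cutEdges G X)) 2 with hone | htwo
  · refine exists_sideGood_of_unique hcl hf hdeg hcore hz (fun v hv w w' hw hw' h h' => ?_) hsize
    have := card_le_one.1 (Nat.le_of_lt_succ hone) (v, w) (mem_cutEdges.2 ⟨hv, hw, h⟩) (v, w')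
      (mem_cutEdges.2 ⟨hv, hw', h'⟩)
    exact (Prod.ext_iff.1 this).2
  have hfull : ∀ v, f v * k ≤ deg G v + 1 := by
    obtain ⟨S, hne, hS, hSdeg⟩ := exists_closed_of_not_good (by omega) hdeg hcore hG
    exact fun v => (hSdeg v (hcl S hne hS ▸ Set.mem_univ v)).2
  suffices h : ∃ A B : Finset V, Disjoint A B ∧ (∀ w, w ∈ A ∨ w ∈ B ↔ w ∈ X ∧ G.Adj u w) ∧
      #A + #(cutEdges G X) ≤ k ∧ #B ≤ (f u - 1) * k ∧
      (#B = (f u - 1) * k → B.Nonempty → deg G u = f u * k) ∧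
      (B.Nonempty → ∃ b' ∈ B, ∃ b ∈ A,
        Relation.ReflTransGen (fun v w => G.Adj v w ∧ w ≠ u) b' b) by
    obtain ⟨A, B, hAB, hmem, hA, hB, hB', hconn⟩ := h
    obtain ⟨c, hc⟩ := exists_good_splitGraph hcl hdeg hcore hu hz hstar hAB hmem (by omega) hB hB'
      hconn
    exact exists_sideGood_of_good_splitGraph hf hu hz hstar hAB hmem hA hc
  set N : Finset V := {w | w ∈ X ∧ G.Adj u w} with hN
  have hNmem : ∀ w, w ∈ N ↔ w ∈ X ∧ G.Adj u w := fun w => by simp [hN]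
  have hdegu : #N + #(cutEdges G X) = deg G u := by
    have h1 : cutEdges G X = ({w | w ∉ X ∧ G.Adj u w} : Finset V).image fun w => (u, w) := by
      ext ⟨p, q⟩
      simp only [mem_cutEdges, mem_image, mem_filter, mem_univ, true_and, Prod.mk.injEq]
      constructor
      · rintro ⟨hp, hq, h⟩
        obtain rfl := hstar p hp q hq h
        exact ⟨q, ⟨hq, h⟩, rfl, rfl⟩
      · rintro ⟨w, ⟨hw, h⟩, rfl, rfl⟩
        exact ⟨hu, hw, h⟩
    rw [h1, card_image_of_injective _ (fun w w' h => (Prod.ext_iff.1 h).2), hN, deg,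
      ← card_filter_add_card_filter_not (s := ({w | G.Adj u w} : Finset V)) (fun w => w ∈ X),
      filter_filter, filter_filter]
    simp only [and_comm]
  have hdu := hdeg u
  have hfu := hfull u
  -- With capacity 1 at `u`, all inner edges go to `z`; the cut has at least two edges, so `z` still
  -- has degree at most `k - 2`.
  rcases Nat.lt_or_ge (f u) 2 with hf1 | hf2
  · have hf1 : f u = 1 := by have := hf u; omega
    rw [hf1] at hdu
    exact ⟨N, ∅, by simp, by simp [hNmem], by omega, by simp, by simp, by simp⟩
  have h2k : 2 * k ≤ f u * k := Nat.mul_le_mul_right k hf2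
  obtain ⟨b, hb⟩ : N.Nonempty := card_pos.1 (by omega)
  have hbN := (hNmem b).1 hb
  -- The split needs a vertex of `B` joined to one of `A` in `G - u`. Either `b` has such a
  -- companion `v`, or `ub` is a bridge.
  by_cases hC : ∀ v, Relation.ReflTransGen (fun v w => G.Adj v w ∧ w ≠ u) b v → G.Adj u v → v = b
  · exact absurd (exists_good_of_bridge hcl hf hdeg hcore hbN.2 (by omega) hC) hG
  push Not at hC
  obtain ⟨v, hbv, huv, hne⟩ := hC
  have hvX : v ∈ X ∧ v ≠ u := by
    clear huv hne
    induction hbv with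
    | refl => exact ⟨hbN.1, hbN.2.ne'⟩
    | @tail p q _ h ih =>
      refine ⟨?_, h.2⟩
      by_contra hq
      exact ih.2 (hstar p ih.1 q hq h.1)
  have hvN : v ∈ N.erase b := mem_erase.2 ⟨hne, (hNmem v).2 ⟨hvX.1, huv⟩⟩
  -- `A` contains `v` but not `b`. Its size makes the `A`-edges and cut edges exactly `k` in number,
  -- leaving `deg G u - k` edges for `B`; these fill the reduced capacity only if `u` is a core
  -- vertex.
  obtain ⟨A, hvA, hAN, hA⟩ := exists_subsuperset_card_eq (singleton_subset_iff.2 hvN)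
    (n := k - #(cutEdges G X)) (by rw [card_singleton]; omega)
    (by rw [card_erase_of_mem hb]; omega)
  have hAN' : A ⊆ N := hAN.trans (erase_subset _ _)
  have hB : #(N \ A) = deg G u - k := by
    rw [card_sdiff_of_subset hAN', hA]
    omega
  have hfk : (f u - 1) * k = f u * k - k := by rw [Nat.sub_mul, one_mul]
  refine ⟨A, N \ A, disjoint_sdiff, ?_, by omega, by omega, fun h _ => by omega, fun _ => ?_⟩
  · intro w
    rw [← hNmem, mem_sdiff]
    exact ⟨fun h => h.elim (fun h => hAN' h) And.left, fun h => (em (w ∈ A)).imp_right (⟨h, ·⟩)⟩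
  · exact ⟨b, mem_sdiff.2 ⟨hb, fun h => (mem_erase.1 (hAN h)).1 rfl⟩, v,
      singleton_subset_iff.1 hvA, hbv⟩

/-- A graph with a small cut that is a matching or a star can be colored. -/
theorem exists_good_of_cut (hG : G.Connected) (hf : ∀ v, 0 < f v)
    (hdeg : ∀ v, deg G v ≤ f v * k)
    (hcore : ∀ v, deg G v = f v * k → #{w | G.Adj v w ∧ deg G w = f w * k} ≤ 2)
    (F : Finset (Sym2 V)) (hcut : IsEdgeCut G F) (hsize : #F + 2 ≤ k)
    (hF : IsMatchingEdges F ∨ IsStarEdges F) : ∃ c : Sym2 V → Fin k, Good G f c := by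
  have hcl : ∀ S : Set V, S.Nonempty → (∀ v ∈ S, ∀ w, G.Adj v w → w ∈ S) → S = Set.univ := by
    rintro S ⟨v, hv⟩ hS
    refine Set.eq_univ_of_forall fun w => ?_
    obtain ⟨p⟩ := hG.preconnected v w
    induction p with
    | nil => exact hv
    | cons h _ ih => exact ih (hS _ hv _ h)
  obtain ⟨x, z, hxz⟩ : ∃ x z, ¬ (G.deleteEdges (F : Set (Sym2 V))).Reachable x z := by
    by_contra! h
    have : Subsingleton (G.deleteEdges (F : Set (Sym2 V))).ConnectedComponent :=
      SimpleGraph.Preconnected.subsingleton_connectedComponent h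
    have h1 := Finite.card_le_one_iff_subsingleton.2 this
    have h2 := hcut.2
    have : Nonempty G.ConnectedComponent := ⟨G.connectedComponentMk hG.nonempty.some⟩
    have := Nat.card_pos (α := G.ConnectedComponent)
    omega
  -- All edges leaving this component of `G - F` belong to `F`, so they inherit its size bound and
  -- its matching or star shape.
  set X : Set V := {v | (G.deleteEdges (F : Set (Sym2 V))).Reachable x v} with hX
  have hXF : ∀ p ∈ X, ∀ q, q ∉ X → G.Adj p q → s(p, q) ∈ F := by
    intro p hp q hq h
    by_contra hpq
    refine hq (SimpleGraph.Reachable.trans hp (SimpleGraph.Adj.reachable ?_))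
    rw [SimpleGraph.deleteEdges_adj]
    exact ⟨h, hpq⟩
  have hxX : x ∈ X := SimpleGraph.Reachable.refl _
  have hcard : #(cutEdges G X) ≤ #F := by
    refine card_le_card_of_injOn (fun p => s(p.1, p.2)) ?_ ?_
    · intro p hp
      obtain ⟨h1, h2, h3⟩ := mem_cutEdges.1 hp
      exact hXF _ h1 _ h2 h3
    · intro p hp p' hp' h
      obtain ⟨h1, h2, -⟩ := mem_cutEdges.1 hp
      obtain ⟨h1', h2', -⟩ := mem_cutEdges.1 hp'
      rcases Sym2.eq_iff.1 h with h | h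
      · exact Prod.ext h.1 h.2
      · exact absurd (h.1 ▸ h1) h2'
  rcases hF with hF | ⟨u, hF⟩
  · refine exists_good_of_matching_cut hcl hf hdeg hcore hxX hxz ?_ ?_
      ((Nat.add_le_add_right hcard 2).trans hsize)
    · intro p hp w w' hw hw' h h'
      by_contra hne
      exact hF _ (hXF p hp w hw h) _ (hXF p hp w' hw' h') (fun he => hne (Sym2.congr_right.1 he)) p
        ⟨Sym2.mem_mk_left _ _, Sym2.mem_mk_left _ _⟩
    · intro p hp w hw w' hw' h h'
      by_contra hne
      exact hF _ (hXF w hw p hp h.symm) _ (hXF w' hw' p hp h'.symm)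
        (fun he => hne (Sym2.congr_left.1 he)) p ⟨Sym2.mem_mk_right _ _, Sym2.mem_mk_right _ _⟩
  · by_cases huX : u ∈ X
    · refine exists_good_of_star_cut hcl hf hdeg hcore huX hxz (fun p hp q hq h => ?_)
        ((Nat.add_le_add_right hcard 2).trans hsize)
      rcases Sym2.mem_iff.1 (hF _ (hXF p hp q hq h)) with h | h
      · exact h.symm
      · exact absurd (h ▸ huX) hq
    · refine exists_good_of_star_cut (X := Xᶜ) hcl hf hdeg hcore huX (not_not.2 hxX)
        (fun p hp q hq h => ?_)
        ((Nat.add_le_add_right (card_cutEdges_compl_le.trans hcard) 2).trans hsize)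
      rcases Sym2.mem_iff.1 (hF _ (hXF q (not_not.1 hq) p hp h.symm)) with h | h
      · exact absurd (h ▸ not_not.1 hq) huX
      · exact h.symm

theorem degree_eq_deg (v : V) [Fintype (G.neighborSet v)] : G.degree v = deg G v := by
  rw [← SimpleGraph.card_neighborFinset_eq_degree, deg]
  congr 1
  ext w
  simp

theorem isFColorable_of_good {c : Sym2 V → Fin k} (hc : Good G f c) : IsFColorable G f k := by
  refine ⟨fun e => c e, fun v a => le_trans ?_ (hc v a)⟩
  rw [← Set.ncard_image_of_injective _ Subtype.val_injective, cnt, ← Set.ncard_coe_finset]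
  refine le_trans (Set.ncard_le_ncard ?_ (Set.toFinite _))
    (Set.ncard_image_le (f := fun w => s(v, w)) (Set.toFinite _))
  rintro _ ⟨⟨e, he⟩, ⟨hv, ha⟩, rfl⟩
  obtain ⟨w, rfl⟩ := hv
  exact ⟨w, by simpa using ⟨he, ha⟩, rfl⟩

theorem deg_le_of_isFColorable (h : IsFColorable G f k) (v : V) : deg G v ≤ f v * k := by
  obtain ⟨c, hc⟩ := h
  let g : {w // G.Adj v w} → Fin k := fun w => c ⟨s(v, w), w.2⟩
  have h1 := card_le_mul_card_image (f := g) univ (f v) fun a _ => by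
    rw [← Set.ncard_coe_finset]
    refine le_trans (Set.ncard_le_ncard_of_injOn (fun w => ⟨s(v, w), w.2⟩) ?_ ?_ (Set.toFinite _))
      (hc v a)
    · intro w hw
      exact ⟨Sym2.mem_mk_left _ _, by simpa using hw⟩
    · intro w _ w' _ h
      exact Subtype.ext (Sym2.congr_right.1 (Subtype.ext_iff.1 h))
  have h2 : #(univ.image g) ≤ k := (card_le_univ _).trans_eq (Fintype.card_fin k)
  rw [card_univ, Fintype.card_subtype] at h1
  exact h1.trans (Nat.mul_le_mul_left _ h2)

theorem card_core_neighbors_le (h : fCoreMaxDegree G f ≤ 2) (v : V)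
    (hv : deg G v = f v * fMaxDegree G f) :
    #{w | G.Adj v w ∧ deg G w = f w * fMaxDegree G f} ≤ 2 := by
  unfold fCoreMaxDegree at h
  have hmem : ∀ w, deg G w = f w * fMaxDegree G f → w ∈ fMaxVertices G f := fun w hw =>
    (degree_eq_deg w).trans hw
  refine le_trans ?_ (((fCore G f).degree_le_maxDegree ⟨v, hmem v hv⟩).trans h)
  rw [← SimpleGraph.card_neighborFinset_eq_degree]
  refine le_trans (card_le_card ?_) (card_image_le (f := Subtype.val))
  intro w hw
  obtain ⟨h1, h2⟩ := (mem_filter.1 hw).2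
  refine mem_image.2 ⟨⟨w, hmem w h2⟩, ?_, rfl⟩
  rw [SimpleGraph.mem_neighborFinset]
  exact h1

theorem deg_le_mul_fMaxDegree (hf : ∀ v, 0 < f v) (v : V) : deg G v ≤ f v * fMaxDegree G f := by
  have h : ⌈(G.degree v : ℚ) / (f v : ℚ)⌉₊ ≤ fMaxDegree G f :=
    Finset.le_sup (f := fun v => ⌈(G.degree v : ℚ) / (f v : ℚ)⌉₊) (mem_univ v)
  rw [Nat.ceil_le, div_le_iff₀ (by exact_mod_cast hf v), degree_eq_deg, mul_comm] at h
  exact_mod_cast h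

theorem fMaxDegree_le_of_isFColorable (hf : ∀ v, 0 < f v) (h : IsFColorable G f k) :
    fMaxDegree G f ≤ k := by
  refine Finset.sup_le fun v _ => ?_
  rw [Nat.ceil_le, div_le_iff₀ (by exact_mod_cast hf v), degree_eq_deg, mul_comm]
  exact_mod_cast deg_le_of_isFColorable h v

end Main

end FColoring

theorem mainTheorem1 {V : Type*} [Fintype V] (G : SimpleGraph V) (hG : G.Connected)
    (f : V → ℕ) (hf : ∀ v, 0 < f v)
    (hcore : FColoring.fCoreMaxDegree G f ≤ 2)
    (F : Finset (Sym2 V)) (hcut : FColoring.IsEdgeCut G F)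
    (hsize : F.card + 2 ≤ FColoring.fMaxDegree G f)
    (hF : FColoring.IsMatchingEdges F ∨ FColoring.IsStarEdges F) :
    FColoring.IsFClassOne G f := by
  obtain ⟨c, hc⟩ := FColoring.exists_good_of_cut hG hf (FColoring.deg_le_mul_fMaxDegree hf)
    (FColoring.card_core_neighbors_le hcore) F hcut hsize hF
  have hcol := FColoring.isFColorable_of_good hc
  refine le_antisymm (Nat.sInf_le hcol) ?_
  exact FColoring.fMaxDegree_le_of_isFColorable hf
    (Nat.sInf_mem (FColoring.exists_isFColorable G f hf))
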